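/- **Setting.** Fix integers $b\ge 1$ (packets per batch), $n\ge 0$, a finite node set with a source $s$ (Alice) and a destination $t$ (Bob), and a bound $m$ on the number of transmissions per stage. In stage $i=1,2,\dots$ the network is a (random) hypergraph whose hyperedges are the transmissions of the stage, in temporal order, each from one node to a set of receiving nodes. Let $c_i\le\bar c$ be the number of transmissions by Alice in stage $i$, and let the capacity $M_i$ be the minimum cut from $s$ to $t$, i.e. the least number of transmissions that meet every causal chain of transmissions from $s$ to $t$. Let $z_i\le c_i$ be the number of errors in stage $i$: the adversary Calvin may control any set of transmissions whose minimum cut to $t$ is at most $z_i$. **The secret-channel scheme over $\mathbb F_q$.** The message is $W\in\mathbb F_q^{b\times n}$, and $X_0=(W\ \ I_b)$. In stage $i$ Alice draws a uniformly random matrix $K_i\in\mathbb F_q^{c_i\times b}$ and sends the rows of $X_i=K_iX_0$ on her $c_i$ transmissions. Every other node transmits random linear combinations, with independent uniform coefficients, of the packets it has received in the stage. Calvin adds arbitrary errors to the packets on the transmissions he controls; he knows everything (the message, all networks, all $K_i$ and all coding coefficients) except the secret symbols below. Over a secret channel Alice sends Bob i.i.d. uniform symbols $r_j\in\mathbb F_q$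 ($bc_i$ of them in stage $i$, one more in stage $1$) and the hashes $H_i=X_0D_i$, where the column of $D_i$ for $r_j$ is $(r_j,r_j^2,\dots,r_j^{n+b})^T$. With $Y^{(i)}$ the matrix of all packets received by Bob in stages $1,\dots,i$, $D^{(i)}=[D_1\cdots D_i]$ and $H^{(i)}=[H_1\cdots H_i]$, Bob solves $X^sY^{(i)}D^{(i)}=H^{(i)}$. If there is no solution he waits for stage $i+1$. Otherwise the session ends: he outputs $X^sY^{(i)}$ if this product is the same for all solutions $X^s$, and declares failure if not. The networks and the $z_i$ are independent of the random choices of Alice, of the network nodes and of the secret symbols, and do not depend on $q$. The rate of a session is $b/i$ if Bob outputs $X_0$ after $i$ stages, and $0$ if he never outputs $X_0$. **Theorem 2 (rate).** Suppose the pairs $(M_i,z_i)$, $i=1,2,\dots$, are i.i.d. and $\mathbb E[M]-\mathbb E[z]\ge\epsilon$ for some $\epsilon>0$. Let $$N=\min\Big\{i\ge1:\ b+\sum_{j=1}^i z_j\le\sum_{j=1}^i M_j\Big\}.$$ Then: 1. $N<\infty$ almost surely. 2. As $q\to\infty$, uniformly over all messages $W$ and all strategies of Calvin, the probability that Bob decodes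 $X_0$ correctly after at most $N$ stages tends to $1$. 3. On average the code achieves the rate $$r=\mathbb E\Big[\frac bN\Big]\ \ge\ \frac{b}{b+\bar c-1}\,\big(\mathbb E[M]-\mathbb E[z]\big),$$ in the sense that this inequality holds and that for every $\delta>0$, for all sufficiently large $q$, the expected rate of a session is at least $\mathbb E[b/N]-\delta$, uniformly over all messages and all strategies of Calvin. -/

import Mathlib

open MeasureTheory ProbabilityTheory

noncomputable section

namespace RatelessCode

/-! ### The network during one stage -/

/-- The network during one stage: a directed hypergraph on the node set `V` with hyperedges
`0, …, m - 1`.  Every hyperedge is one packet transmission, from the node `tail e` to all the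
nodes in `heads e`; a lost transmission has `heads e = ∅`.  The hyperedges are numbered in the
order in which the transmissions of the stage take place (for an acyclic hypergraph: in a
topological order). -/
structure Hypernet (V : Type*) (m : ℕ) where
  tail : Fin m → V
  heads : Fin m → Finset V

namespace Hypernet

variable {V : Type*} [DecidableEq V] {m : ℕ}

/-- The transmissions of the source `s`. -/
def sourceEdges (g : Hypernet V m) (s : V) : Finset (Fin m) :=
  Finset.univ.filter fun e => g.tail e = s

/-- The number of transmission opportunities of the source `s` in this stage. -/
def opportunities (g : Hypernet V m) (s : V) : ℕ := (g.sourceEdges s).card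

/-- The packet sent on `e` is available at the node that sends on `e'` when it does so, and that
node is not the source (which sends its own encoded packets only). -/
def Feeds (g : Hypernet V m) (s : V) (e e' : Fin m) : Prop :=
  e < e' ∧ g.tail e' ∈ g.heads e ∧ g.tail e' ≠ s

instance (g : Hypernet V m) (s : V) (e e' : Fin m) : Decidable (g.Feeds s e e') :=
  inferInstanceAs (Decidable (_ ∧ _ ∧ _))

/-- The set `C` of hyperedges separates the set `A` of hyperedges from the node `t`: every chain
of hyperedges, each feeding the next, from a member of `A` to a hyperedge received by `t`
contains a member of `C`. -/
def IsCut (g : Hypernet V m) (s t : V) (A C : Finset (Fin m)) : Prop :=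
  ∀ e ∈ A, e ∉ C → ∀ e', Relation.ReflTransGen (fun x y => g.Feeds s x y ∧ y ∉ C) e e' →
    t ∉ g.heads e'

/-- The minimum cut from the set `A` of hyperedges to the node `t`.  (The set of cuts is never
empty: `A` itself is one.) -/
def minCut (g : Hypernet V m) (s t : V) (A : Finset (Fin m)) : ℕ :=
  sInf {k | ∃ C : Finset (Fin m), g.IsCut s t A C ∧ C.card = k}

/-- The capacity of the stage: the minimum cut from the source `s` to the destination `t`. -/
def capacity (g : Hypernet V m) (s t : V) : ℕ := g.minCut s t (g.sourceEdges s)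

/-- The packets carried by the hyperedges under linear network coding.  The source sends the row
`X e` of its encoded packets on the hyperedge `e`; any other node sends the linear combination,
with coefficients `β e' e`, of the packets that it has received; and the adversary adds the error
`Z e` to the packet on each hyperedge `e` of the set `A` that he controls. -/
def packet {F ι : Type*} [Field F] (g : Hypernet V m) (s : V) (β : Fin m → Fin m → F)
    (X : Fin m → ι → F) (A : Finset (Fin m)) (Z : Fin m → ι → F) (e : Fin m) : ι → F :=
  (if g.tail e = s then X e else 0)
    + (∑ e' : Fin m, if _h : g.Feeds s e' e then β e' e • packet g s β X A Z e' else 0)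
    + (if e ∈ A then Z e else 0)
termination_by e
decreasing_by exact _h.1

end Hypernet

/-! ### A session of the secret channel scheme -/

/-- Everything that determines the course of a session; stages are numbered from `0`.  The symbols
`K i e k` are used for the hyperedges `e` that leave the source, and `r i 0, r i 1, …` are the
secret symbols of stage `i`. -/
structure Session (V F : Type*) (m n b : ℕ) where
  /-- Alice -/
  src : V
  /-- Bob -/
  dst : V
  /-- the networks of the stages -/
  net : ℕ → Hypernet V m
  /-- the message -/
  W : Matrix (Fin b) (Fin n) F
  /-- Alice's encoding matrices -/
  K : ℕ → Matrix (Fin m) (Fin b) F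
  /-- the coding coefficients of the network nodes -/
  β : ℕ → Fin m → Fin m → F
  /-- the secret symbols -/
  r : ℕ → ℕ → F
  /-- the hyperedges that Calvin controls -/
  loc : ℕ → Finset (Fin m)
  /-- the errors that Calvin injects -/
  err : ℕ → Matrix (Fin m) (Fin n ⊕ Fin b) F

namespace Session

variable {V F : Type*} [DecidableEq V] [Field F] {m n b : ℕ} (S : Session V F m n b)

/-- The batch `X₀ = (W I)`. -/
def X₀ : Matrix (Fin b) (Fin n ⊕ Fin b) F := Matrix.fromCols S.W 1

/-- The packet carried by the hyperedge `e` in stage `i`, when Alice sends `Xᵢ = Kᵢ X₀`. -/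
def sent (i : ℕ) (e : Fin m) : Fin n ⊕ Fin b → F :=
  (S.net i).packet S.src (S.β i) (S.K i * S.X₀) (S.loc i) (S.err i) e

/-- Index set of the packets that Bob receives in the first `i` stages. -/
abbrev Rows (i : ℕ) : Type := Σ j : Fin i, {e : Fin m // S.dst ∈ (S.net j).heads e}

/-- Bob's observation `Y⁽ⁱ⁾` after `i` stages. -/
def Y (i : ℕ) : Matrix (S.Rows i) (Fin n ⊕ Fin b) F := fun p => S.sent p.1 p.2.1

/-- The number of secret symbols of stage `i`: it is `b cᵢ`, and one more in the first stage. -/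
def numSecrets (i : ℕ) : ℕ := b * (S.net i).opportunities S.src + if i = 0 then 1 else 0

/-- Index set of the secret symbols of the first `i` stages. -/
abbrev Cols (i : ℕ) : Type := Σ j : Fin i, Fin (S.numSecrets j)

/-- The matrix `D⁽ⁱ⁾`: the column of the secret symbol `r` is `(r, r², …, r ^ (n + b))`. -/
def D (i : ℕ) : Matrix (Fin n ⊕ Fin b) (S.Cols i) F :=
  fun k c => S.r c.1 c.2 ^ ((finSumFinEquiv k : Fin (n + b)).val + 1)

/-- The hashes `H⁽ⁱ⁾ = X₀ D⁽ⁱ⁾` sent over the secret channel. -/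
def H (i : ℕ) : Matrix (Fin b) (S.Cols i) F := S.X₀ * S.D i

/-- `U` solves Bob's decoding equation `U Y⁽ⁱ⁾ D⁽ⁱ⁾ = H⁽ⁱ⁾` after `i` stages. -/
def Solves (i : ℕ) (U : Matrix (Fin b) (S.Rows i) F) : Prop := U * S.Y i * S.D i = S.H i

/-- Bob ends the session after `i` stages (`i ≥ 1`): his equation is solvable then, and it was not
after any smaller number of stages. -/
def StopsAt (i : ℕ) : Prop :=
  1 ≤ i ∧ (∃ U, S.Solves i U) ∧ ∀ j, 1 ≤ j → j < i → ¬ ∃ U, S.Solves j U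

/-- Bob ends the session after `i` stages and decodes correctly: the equation determines the
decoded batch `U Y⁽ⁱ⁾`, and that batch is `X₀`.  (If several batches were possible, Bob would
declare a decoding failure.) -/
def DecodesAt (i : ℕ) : Prop := S.StopsAt i ∧ ∀ U, S.Solves i U → U * S.Y i = S.X₀

open Classical in
/-- The rate of the session, in packets per stage: `b / i` if Bob decodes correctly after `i`
stages, and `0` if he never decodes correctly. -/
def rate : ℝ := if h : ∃ i, S.DecodesAt i then (b : ℝ) / (h.choose : ℝ) else 0

end Session

/-! ### The cut-set condition -/

/-- After `i` stages, with capacities `M` and error counts `z`, the cut-set condition holds. -/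
def CutSet (b : ℕ) (M z : ℕ → ℕ) (i : ℕ) : Prop :=
  1 ≤ i ∧ b + ∑ j ∈ Finset.range i, z j ≤ ∑ j ∈ Finset.range i, M j

/-- The first number of stages at which the cut-set condition holds. -/
def cutSetTime (b : ℕ) (M z : ℕ → ℕ) : ℕ := sInf {i | CutSet b M z i}

/-! ### Random coins and the adversary -/

/-- The law of a family of independent symbols, uniformly distributed on the finite field `F`. -/
def uniformCoins (ι F : Type*) [MeasurableSpace F] : Measure (ι → F) :=
  Measure.infinitePi fun _ => uniformOn (Set.univ : Set F)

/-- The coins of Alice's encoder (`Kᵢ`) and those of the network nodes (`βᵢ`). -/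
abbrev PublicCoins (F : Type*) (m b : ℕ) : Type _ :=
  (ℕ × Fin m × Fin b → F) × (ℕ × Fin m × Fin m → F)

/-- The coins of the secret channel. -/
abbrev SecretCoins (F : Type*) : Type _ := ℕ × ℕ → F

/-- The joint law of the state `ω` of the world, the public coins, and the secret coins. -/
def jointLaw {Ω : Type*} [MeasurableSpace Ω] (P : Measure Ω) (F : Type*) [MeasurableSpace F]
    (m b : ℕ) : Measure ((Ω × PublicCoins F m b) × SecretCoins F) :=
  (P.prod ((uniformCoins (ℕ × Fin m × Fin b) F).prod
    (uniformCoins (ℕ × Fin m × Fin m) F))).prod (uniformCoins (ℕ × ℕ) F)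

/-- A (measurable) strategy of Calvin, who knows everything except the secret coins: in each stage
he chooses the hyperedges that he controls and the errors that he adds there. -/
structure Adversary (Ω : Type*) [MeasurableSpace Ω] (F : Type*) [MeasurableSpace F]
    (m n b : ℕ) where
  loc : ℕ → Ω × PublicCoins F m b → Finset (Fin m)
  err : ℕ → Ω × PublicCoins F m b → Matrix (Fin m) (Fin n ⊕ Fin b) F
  measurable_loc : ∀ i A, MeasurableSet {x | loc i x = A}
  measurable_err : ∀ i Z, MeasurableSet {x | err i x = Z}

/-- The session that results from the networks `G`, the message `W`, Calvin's strategy `adv`, the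
state `ω = x.1.1`, the public coins `x.1.2` and the secret coins `x.2`. -/
def session {V Ω F : Type*} [MeasurableSpace Ω] [MeasurableSpace F] {m n b : ℕ} (s t : V)
    (G : ℕ → Ω → Hypernet V m) (W : Matrix (Fin b) (Fin n) F) (adv : Adversary Ω F m n b)
    (x : (Ω × PublicCoins F m b) × SecretCoins F) : Session V F m n b where
  src := s
  dst := t
  net i := G i x.1.1
  W := W
  K i := fun e k => x.1.2.1 (i, e, k)
  β i := fun e e' => x.1.2.2 (i, e, e')
  r i j := x.2 (i, j)
  loc i := adv.loc i x.1
  err i := adv.err i x.1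

end RatelessCode

end

noncomputable section

namespace RatelessCode

/-! ### Linear dependence of the packets on source symbols and errors -/

namespace Hypernet

variable {V : Type*} [DecidableEq V] {m : ℕ} {F : Type*} [Field F]

/-! With the coins and the controlled set fixed, a stage is linear: every packet is a combination of
source packets plus a combination of injected errors. Received error rows factor through a cut, so
their rank is at most `z` (`finrank_span_errorRow_le`). For generic coding coefficients the received
source rows have rank at least the capacity `M`, a rank form of max-flow min-cut
(`Generic.exists_separates`). Hence the received combinations that annihilate the errors retain at
least `M - z` dimensions, whatever the error values. Once these add up to `b` over the stages,
generic `K i` make every row of `X₀` such a combination (`decodable_of_generic`), and Bob's equation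
is solvable.

Genericity fails with probability `O(1/q)`. Each elementary failure, with all other coins fixed,
allows at most one value of some coin (`measure_le_inv_card_of_shift`). Calvin chooses after seeing
the public coins, so the union bound runs over all the sets he might control; the number of events
still does not depend on `q`.

A wrong solution yields a nonzero vector with zero hashes in a subspace that does not depend on the
secrets and whose dimension is at most the number `k` of secret symbols. Each nonzero vector
survives with probability at most `(d/q)^k`, where `d = n + b`, so a union bound over `q^k` vectors
gives only a constant. But surviving vectors come in punctured lines: a bad outcome has at least `q
- 1` of them, and Markov's inequality supplies the missing factor
(`measure_exists_hash_eq_zero_le`).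

The sums of `M - z` form a random walk with drift `μ = E[M] - E[z]`, and `N` is its passage time to
level `b`. A truncated Wald argument bounds the expectation of `min N k` by `a = (b + cbar - 1) / μ`
for all `k` (`sum_measureReal_unmet_mul_le`). This gives finiteness of `N`, control of its tail and,
by convexity of `1/x`, the rate bound (`le_integral_div_cutSetTime`). Off a rare event Bob decodes
no later than stage `N`, so the rate of the session is at least `b / N`. -/

/-- The coefficients of the source symbols in the packet carried by `e`. -/
def sourceRow (g : Hypernet V m) (s : V) (β : Fin m → Fin m → F) (e : Fin m) : Fin m → F :=
  g.packet s β (fun e' => Pi.single e' 1) ∅ 0 e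

/-- The coefficients of the errors in the packet carried by `e`, when the adversary controls
`A`. -/
def errorRow (g : Hypernet V m) (s : V) (β : Fin m → Fin m → F) (A : Finset (Fin m))
    (e : Fin m) : Fin m → F :=
  g.packet s β 0 A (fun e' => Pi.single e' 1) e

theorem packet_eq {ι : Type*} (g : Hypernet V m) (s : V) (β : Fin m → Fin m → F)
    (X : Fin m → ι → F) (A : Finset (Fin m)) (Z : Fin m → ι → F) (e : Fin m) :
    g.packet s β X A Z e = (if g.tail e = s then X e else 0)
      + (∑ e' : Fin m, if g.Feeds s e' e then β e' e • g.packet s β X A Z e' else 0)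
      + (if e ∈ A then Z e else 0) := by
  rw [packet]
  simp only [dite_eq_ite]

/-- Both sides obey the same recursion along the temporal order. This separates what the network
does from the values of packets and errors. -/
theorem packet_eq_rows {ι : Type*} (g : Hypernet V m) (s : V) (β : Fin m → Fin m → F)
    (X : Fin m → ι → F) (A : Finset (Fin m)) (Z : Fin m → ι → F) (e : Fin m) :
    g.packet s β X A Z e
      = ∑ e', g.sourceRow s β e e' • X e' + ∑ e', g.errorRow s β A e e' • Z e' := by
  induction e using WellFoundedLT.induction with
  | _ e ih =>
  have hin : ∀ e', (if g.Feeds s e' e then β e' e • g.packet s β X A Z e' else 0)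
      = (∑ e'', (if g.Feeds s e' e then β e' e • g.sourceRow s β e' else 0) e'' • X e'')
        + ∑ e'', (if g.Feeds s e' e then β e' e • g.errorRow s β A e' else 0) e'' • Z e'' := by
    intro e'
    split_ifs with h
    · rw [ih e' h.1]
      simp [Finset.smul_sum, smul_smul]
    · simp
  have hs : (if g.tail e = s then X e else 0)
      = ∑ e'', (if g.tail e = s then (Pi.single e 1 : Fin m → F) else 0) e'' • X e'' := by
    split_ifs with h
    · rw [Finset.sum_eq_single e] <;> simp +contextual
    · simp
  have hz : (if e ∈ A then Z e else 0)
      = ∑ e'', (if e ∈ A then (Pi.single e 1 : Fin m → F) else 0) e'' • Z e'' := by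
    split_ifs with h
    · rw [Finset.sum_eq_single e] <;> simp +contextual
    · simp
  have hp : g.sourceRow s β e = (if g.tail e = s then (Pi.single e 1 : Fin m → F) else 0)
      + ∑ e' : Fin m, if g.Feeds s e' e then β e' e • g.sourceRow s β e' else 0 := by
    rw [sourceRow, packet_eq]
    simp [sourceRow]
  have hq : g.errorRow s β A e = (∑ e' : Fin m, if g.Feeds s e' e then
      β e' e • g.errorRow s β A e' else 0)
      + (if e ∈ A then (Pi.single e 1 : Fin m → F) else 0) := by
    rw [errorRow, packet_eq]
    simp [errorRow]
  rw [packet_eq, Finset.sum_congr rfl fun e' _ => hin e', hs, hz, hp, hq, Finset.sum_add_distrib,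
    Finset.sum_comm, Finset.sum_comm (f := fun e' e'' =>
      (if g.Feeds s e' e then β e' e • g.errorRow s β A e' else 0) e'' • Z e'')]
  simp only [Pi.add_apply, Finset.sum_apply, add_smul, Finset.sum_smul, Finset.sum_add_distrib]
  abel

theorem sourceRow_eq (g : Hypernet V m) (s : V) (β : Fin m → Fin m → F) (e : Fin m) :
    g.sourceRow s β e = (if g.tail e = s then (Pi.single e 1 : Fin m → F) else 0)
      + ∑ e' : Fin m, if g.Feeds s e' e then β e' e • g.sourceRow s β e' else 0 := by
  rw [sourceRow, packet_eq]
  simp [sourceRow]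

theorem errorRow_eq (g : Hypernet V m) (s : V) (β : Fin m → Fin m → F) (A : Finset (Fin m))
    (e : Fin m) :
    g.errorRow s β A e = (∑ e' : Fin m, if g.Feeds s e' e then
      β e' e • g.errorRow s β A e' else 0)
      + (if e ∈ A then (Pi.single e 1 : Fin m → F) else 0) := by
  rw [errorRow, packet_eq]
  simp [errorRow]

theorem sourceRow_apply_of_lt (g : Hypernet V m) (s : V) (β : Fin m → Fin m → F) {e k : Fin m}
    (h : e < k) : g.sourceRow s β e k = 0 := by
  induction e using WellFoundedLT.induction with
  | _ e ih =>
  rw [sourceRow_eq]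
  simp only [Pi.add_apply, Finset.sum_apply]
  rw [Finset.sum_eq_zero, add_zero]
  · split_ifs <;> simp [h.ne']
  · intro e' _
    split_ifs with hf
    · simp [ih e' hf.1 (hf.1.trans h)]
    · rfl

theorem sourceRow_apply_of_tail_ne (g : Hypernet V m) (s : V) (β : Fin m → Fin m → F)
    (e : Fin m) {k : Fin m} (h : g.tail k ≠ s) : g.sourceRow s β e k = 0 := by
  induction e using WellFoundedLT.induction with
  | _ e ih =>
  rw [sourceRow_eq]
  simp only [Pi.add_apply, Finset.sum_apply]
  rw [Finset.sum_eq_zero, add_zero]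
  · split_ifs with h'
    · have : k ≠ e := by rintro rfl; exact h h'
      simp [this]
    · rfl
  · intro e' _
    split_ifs with hf
    · simp [ih e' hf.1]
    · rfl

theorem sourceRow_of_tail_eq (g : Hypernet V m) (s : V) (β : Fin m → Fin m → F) {e : Fin m}
    (h : g.tail e = s) : g.sourceRow s β e = Pi.single e 1 := by
  rw [sourceRow_eq, if_pos h, Finset.sum_eq_zero, add_zero]
  intro e' _
  rw [if_neg]
  exact fun hf => hf.2.2 h

/-! ### Errors pass through a cut -/

/-- The hyperedges received by `t`. -/
def received (g : Hypernet V m) (t : V) : Finset (Fin m) := Finset.univ.filter fun e => t ∈ g.heads e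

@[simp] theorem mem_received {g : Hypernet V m} {t : V} {e : Fin m} :
    e ∈ g.received t ↔ t ∈ g.heads e := by simp [received]

/-- Trace the packet backwards. An edge outside `C` with a chain to `t` avoiding `C` cannot lie in
`A`, so its error row is a combination of the rows feeding it; the tracing stops only at edges of
`C`. -/
theorem errorRow_mem_span_of_isCut (g : Hypernet V m) (s t : V) (β : Fin m → Fin m → F)
    {A C : Finset (Fin m)} (hC : g.IsCut s t A C) (e : Fin m) (he : t ∈ g.heads e) :
    g.errorRow s β A e ∈ Submodule.span F (g.errorRow s β A '' C) := by
  -- The induction meets edges that are not received by `t` themselves but lead to a received edge.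
  suffices ∀ e e', t ∈ g.heads e' → Relation.ReflTransGen (fun x y => g.Feeds s x y ∧ y ∉ C) e e' →
      g.errorRow s β A e ∈ Submodule.span F (g.errorRow s β A '' C) from this e e he .refl
  intro e
  induction e using WellFoundedLT.induction with
  | _ e ih =>
  intro e' he' hchain
  by_cases heC : e ∈ C
  · exact Submodule.subset_span ⟨e, heC, rfl⟩
  have heA : e ∉ A := fun h => hC e h heC e' hchain he'
  rw [errorRow_eq, if_neg heA, add_zero]
  refine Submodule.sum_mem _ fun x _ => ?_
  split_ifs with hf
  · exact Submodule.smul_mem _ _ (ih x hf.1 e' he' (.head ⟨hf, heC⟩ hchain))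
  · exact zero_mem _

theorem exists_isCut_card_eq {V : Type*} (g : Hypernet V m) (s t : V) (A : Finset (Fin m)) :
    ∃ C, g.IsCut s t A C ∧ C.card = g.minCut s t A :=
  Nat.sInf_mem (s := {k | ∃ C : Finset (Fin m), g.IsCut s t A C ∧ C.card = k})
    ⟨A.card, A, fun _ h h' => absurd h h', rfl⟩

theorem minCut_le_card {V : Type*} (g : Hypernet V m) (s t : V) {A C : Finset (Fin m)}
    (h : g.IsCut s t A C) : g.minCut s t A ≤ C.card :=
  Nat.sInf_le ⟨C, h, rfl⟩

theorem capacity_le_opportunities (g : Hypernet V m) (s t : V) :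
    g.capacity s t ≤ g.opportunities s :=
  g.minCut_le_card s t fun _ h h' => absurd h h'

theorem finrank_span_errorRow_le (g : Hypernet V m) (s t : V) (β : Fin m → Fin m → F)
    (A : Finset (Fin m)) :
    Module.finrank F (Submodule.span F (g.errorRow s β A '' (g.received t))) ≤ g.minCut s t A := by
  classical
  obtain ⟨C, hC, hcard⟩ := g.exists_isCut_card_eq s t A
  have hle : Submodule.span F (g.errorRow s β A '' (g.received t))
      ≤ Submodule.span F (g.errorRow s β A '' C) := by
    rw [Submodule.span_le]
    rintro _ ⟨e, he, rfl⟩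
    exact g.errorRow_mem_span_of_isCut s t β hC e (by simpa using he)
  calc _ ≤ _ := Submodule.finrank_mono hle
    _ ≤ (C.image (g.errorRow s β A)).card := by
      rw [← Finset.coe_image]; exact finrank_span_finset_le_card _
    _ ≤ C.card := Finset.card_image_le
    _ = _ := hcard

/-! ### Coding coefficients that attain the capacity -/

/-- The coefficients are generic: unless the packets received before the transmission `e` are
combinations of the packets on `R`, neither is the packet on `e`. -/
def Generic (g : Hypernet V m) (s : V) (β : Fin m → Fin m → F) : Prop :=
  ∀ (e' e : Fin m) (R : Finset (Fin m)), g.Feeds s e' e → (∀ r ∈ R, r < e) →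
    g.sourceRow s β e' ∉ Submodule.span F (g.sourceRow s β '' R) →
    g.sourceRow s β e ∉ Submodule.span F (g.sourceRow s β '' R)

/-- The set `C` meets all chains of hyperedges from the source to the set `R`. -/
def Separates (g : Hypernet V m) (s : V) (C R : Finset (Fin m)) : Prop :=
  ∀ e ∈ g.sourceEdges s, e ∉ C → ∀ e',
    Relation.ReflTransGen (fun x y => g.Feeds s x y ∧ y ∉ C) e e' → e' ∉ R

/-- Peel off the latest edge `e` of `R`. If its row is independent of the others, put `e` into the
cut and pay with one dimension. If it is dependent, genericity forces the rows of all edges feeding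
`e` into the same span, so `e` can be traded for these earlier edges at no cost. -/
theorem Generic.exists_separates {g : Hypernet V m} {s : V} {β : Fin m → Fin m → F}
    (hβ : g.Generic s β) (R : Finset (Fin m)) :
    ∃ C, g.Separates s C R ∧
      C.card ≤ Module.finrank F (Submodule.span F (g.sourceRow s β '' R)) := by
  suffices ∀ k : ℕ, ∀ R : Finset (Fin m), (∀ r ∈ R, r.val < k) → ∃ C, g.Separates s C R ∧
      C.card ≤ Module.finrank F (Submodule.span F (g.sourceRow s β '' R)) from
    this m R fun r _ => r.2
  intro k
  induction k with
  | zero =>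
    intro R hR
    exact ⟨∅, fun e _ _ e' _ he' => absurd (hR e' he') (by simp), by simp⟩
  | succ k ih =>
    intro R hR
    by_cases hk : ∃ e ∈ R, e.val = k
    swap
    · exact ih R fun r hr => lt_of_le_of_ne (Nat.lt_succ_iff.1 (hR r hr)) fun h => hk ⟨r, hr, h⟩
    obtain ⟨e, heR, rfl⟩ := hk
    set R' := R.erase e with hR'
    have hlt : ∀ r ∈ R', r.val < e.val := fun r hr =>
      lt_of_le_of_ne (Nat.lt_succ_iff.1 (hR r (Finset.mem_of_mem_erase hr)))
        fun h => Finset.ne_of_mem_erase hr (Fin.ext h)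
    have hins : R = insert e R' := (Finset.insert_erase heR).symm
    have hspan : Submodule.span F (g.sourceRow s β '' R)
        = Submodule.span F {g.sourceRow s β e} ⊔ Submodule.span F (g.sourceRow s β '' R') := by
      rw [hins, Finset.coe_insert, Set.image_insert_eq, Submodule.span_insert]
    by_cases hmem : g.sourceRow s β e ∈ Submodule.span F (g.sourceRow s β '' R')
    · have hspan' : Submodule.span F (g.sourceRow s β '' R)
          = Submodule.span F (g.sourceRow s β '' R') := by
        rw [hspan, sup_eq_right, Submodule.span_singleton_le_iff_mem]
        exact hmem
      -- The row of a source edge `e` has coordinate `e` equal to one, while all earlier rows vanish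
      -- there.
      have htail : g.tail e ≠ s := by
        intro h
        have h0 : ∀ v ∈ Submodule.span F (g.sourceRow s β '' R'), v e = 0 := by
          intro v hv
          have : Submodule.span F (g.sourceRow s β '' R')
              ≤ LinearMap.ker (LinearMap.proj (R := F) (φ := fun _ : Fin m => F) e) := by
            rw [Submodule.span_le]
            rintro _ ⟨r, hr, rfl⟩
            exact g.sourceRow_apply_of_lt s β (hlt r hr)
          exact this hv
        have := h0 _ hmem
        rw [g.sourceRow_of_tail_eq s β h] at this
        simp at this
      classical
      -- A chain ending in `e` has a last step from an edge feeding `e`, so a set separating `R''`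
      -- also separates `R`.
      set R'' := R' ∪ Finset.univ.filter (fun x => g.Feeds s x e) with hR''
      have hspan'' : Submodule.span F (g.sourceRow s β '' R'')
          = Submodule.span F (g.sourceRow s β '' R') := by
        apply le_antisymm
        · rw [Submodule.span_le]
          rintro _ ⟨r, hr, rfl⟩
          rw [Finset.mem_coe, hR'', Finset.mem_union] at hr
          rcases hr with hr | hr
          · exact Submodule.subset_span ⟨r, hr, rfl⟩
          · by_contra hcon
            exact hβ r e R' (Finset.mem_filter.1 hr).2 hlt hcon hmem
        · exact Submodule.span_mono (Set.image_mono (by simp [hR'']))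
      obtain ⟨C, hC, hcard⟩ := ih R'' (by
        intro r hr
        rcases Finset.mem_union.1 hr with hr | hr
        · exact hlt r hr
        · exact (Finset.mem_filter.1 hr).2.1)
      refine ⟨C, ?_, by rw [hspan', ← hspan'']; exact hcard⟩
      intro a ha haC e' hchain he'
      rw [hins, Finset.mem_insert] at he'
      rcases he' with rfl | he'
      · rcases Relation.ReflTransGen.cases_tail hchain with h | ⟨c, hc, hce⟩
        · subst h
          exact htail (Finset.mem_filter.1 ha).2
        · exact hC a ha haC c hc (by simp [hR'', hce.1])
      · exact hC a ha haC e' hchain (by simp [hR'', he'])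
    · obtain ⟨C, hC, hcard⟩ := ih R' hlt
      classical
      refine ⟨insert e C, ?_, ?_⟩
      · intro a ha haC e' hchain he'
        have haC' : a ∉ C := fun h => haC (Finset.mem_insert_of_mem h)
        rw [hins, Finset.mem_insert] at he'
        rcases he' with rfl | he'
        · rcases Relation.ReflTransGen.cases_tail hchain with h | ⟨c, hc, hce⟩
          · subst h
            exact haC (Finset.mem_insert_self _ _)
          · exact hce.2 (Finset.mem_insert_self _ _)
        · exact hC a ha haC' e' (Relation.ReflTransGen.mono (fun x y h =>
            ⟨h.1, fun h' => h.2 (Finset.mem_insert_of_mem h')⟩) _ _ hchain) he'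
      · have hlt' : Module.finrank F (Submodule.span F (g.sourceRow s β '' R'))
            < Module.finrank F (Submodule.span F (g.sourceRow s β '' R)) := by
          apply Submodule.finrank_lt_finrank_of_lt
          rw [hspan]
          refine lt_of_le_of_ne le_sup_right fun h => hmem ?_
          rw [h]
          exact Submodule.mem_sup_left (Submodule.mem_span_singleton_self _)
        have := Finset.card_insert_le e C
        omega

theorem Generic.capacity_le {g : Hypernet V m} {s : V} {β : Fin m → Fin m → F}
    (hβ : g.Generic s β) (t : V) :
    g.capacity s t ≤ Module.finrank F (Submodule.span F (g.sourceRow s β '' (g.received t))) := by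
  obtain ⟨C, hC, hcard⟩ := hβ.exists_separates (g.received t)
  refine le_trans (g.minCut_le_card s t fun e he heC e' hchain he' => ?_) hcard
  exact hC e he heC e' hchain (by simpa using he')

/-! ### Combinations of the received packets that are free of errors -/

/-- The combination with coefficients `u` of the rows `p e`, `e ∈ R`. -/
def combine (R : Finset (Fin m)) (p : Fin m → Fin m → F) : (R → F) →ₗ[F] (Fin m → F) :=
  Fintype.linearCombination F fun e : R => p e

theorem range_combine (R : Finset (Fin m)) (p : Fin m → Fin m → F) :
    LinearMap.range (combine R p) = Submodule.span F (p '' R) := by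
  rw [combine, Fintype.range_linearCombination]
  congr 1
  ext v
  simp

/-- The coefficients of the source symbols in the error-free combinations of the packets that are
received by `t`. -/
def cleanRows (g : Hypernet V m) (s t : V) (β : Fin m → Fin m → F) (A : Finset (Fin m)) :
    Submodule F (Fin m → F) :=
  (LinearMap.ker (combine (g.received t) (g.errorRow s β A))).map
    (combine (g.received t) (g.sourceRow s β))

/-- The kernel of `h` has codimension equal to the rank of `h`, and restricting `f` to it loses at
most that much rank. -/
theorem _root_.LinearMap.finrank_range_le_finrank_map_ker_add {U U₁ U₂ : Type*}
    [AddCommGroup U] [Module F U] [FiniteDimensional F U] [AddCommGroup U₁] [Module F U₁]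
    [AddCommGroup U₂] [Module F U₂] (f : U →ₗ[F] U₁) (h : U →ₗ[F] U₂) :
    Module.finrank F (LinearMap.range f)
      ≤ Module.finrank F ((LinearMap.ker h).map f) + Module.finrank F (LinearMap.range h) := by
  have h1 := LinearMap.finrank_range_add_finrank_ker f
  have h2 := LinearMap.finrank_range_add_finrank_ker h
  have h3 := LinearMap.finrank_range_add_finrank_ker (f.domRestrict (LinearMap.ker h))
  have h4 : LinearMap.range (f.domRestrict (LinearMap.ker h)) = (LinearMap.ker h).map f :=
    LinearMap.range_domRestrict _ _
  have h5 : Module.finrank F (LinearMap.ker (f.domRestrict (LinearMap.ker h)))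
      ≤ Module.finrank F (LinearMap.ker f) := by
    refine LinearMap.finrank_le_finrank_of_injective
      (f := ((LinearMap.ker h).subtype.restrict (p := LinearMap.ker (f.domRestrict _))
        (q := LinearMap.ker f) fun x hx => by simpa using hx)) ?_
    intro x y hxy
    apply Subtype.ext
    apply Subtype.ext
    exact congrArg (fun z : LinearMap.ker f => (z : U)) hxy
  rw [h4] at h3
  omega

theorem Generic.capacity_le_finrank_cleanRows_add {g : Hypernet V m} {s : V}
    {β : Fin m → Fin m → F} (hβ : g.Generic s β) (t : V) (A : Finset (Fin m)) :
    g.capacity s t ≤ Module.finrank F (g.cleanRows s t β A) + g.minCut s t A := by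
  have h1 := hβ.capacity_le t
  have h2 := g.finrank_span_errorRow_le s t β A
  have h3 := LinearMap.finrank_range_le_finrank_map_ker_add
    (combine (g.received t) (g.sourceRow s β)) (combine (g.received t) (g.errorRow s β A))
  rw [range_combine, range_combine] at h3
  rw [cleanRows]
  omega

/-- The same coefficients that produce `w` from the source rows cancel the error rows, so they
cancel the errors for every `Z`. -/
theorem sum_smul_mem_span_packet {ι : Type*} {g : Hypernet V m} {s t : V}
    {β : Fin m → Fin m → F} {A : Finset (Fin m)} {w : Fin m → F}
    (hw : w ∈ g.cleanRows s t β A) (X Z : Fin m → ι → F) :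
    ∑ e, w e • X e ∈ Submodule.span F (g.packet s β X A Z '' (g.received t)) := by
  obtain ⟨u, hu, rfl⟩ := hw
  have hu' : combine (g.received t) (g.errorRow s β A) u = 0 := hu
  have key : ∑ e, combine (g.received t) (g.sourceRow s β) u e • X e
      = ∑ e : g.received t, u e • g.packet s β X A Z e := by
    simp only [packet_eq_rows, smul_add, Finset.sum_add_distrib]
    have h0 : ∑ e : g.received t, u e • ∑ e', g.errorRow s β A e e' • Z e' = 0 := by
      have : ∑ e', combine (g.received t) (g.errorRow s β A) u e' • Z e' = 0 := by simp [hu']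
      rw [← this]
      simp only [combine, Fintype.linearCombination_apply, Finset.sum_apply, Finset.sum_smul,
        Finset.smul_sum, Pi.smul_apply, smul_eq_mul, mul_smul]
      rw [Finset.sum_comm]
    rw [h0, add_zero]
    simp only [combine, Fintype.linearCombination_apply, Finset.sum_apply, Finset.sum_smul,
      Finset.smul_sum, Pi.smul_apply, smul_eq_mul, mul_smul]
    rw [Finset.sum_comm]
  rw [key]
  exact Submodule.sum_mem _ fun e _ => Submodule.smul_mem _ _ (Submodule.subset_span ⟨e, e.2, rfl⟩)

end Hypernet

/-! ### Random encoding is invertible -/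

section Encoding

variable {F U ι : Type*} [Field F] [AddCommGroup U] [Module F U] [Fintype ι] {b : ℕ}

/-- The functional that is the combination of the functionals `ξ` with coefficients `K · a`. -/
def encode (ξ : ι → Module.Dual F U) (K : ι → Fin b → F) (a : Fin b) : Module.Dual F U :=
  ∑ p, K p a • ξ p

/-- Unless the earlier combinations span all the functionals `ξ p`, the next one is not in their
span. -/
def EncodeGeneric (ξ : ι → Module.Dual F U) (K : ι → Fin b → F) : Prop :=
  ∀ (a : Fin b) (p : ι), ξ p ∉ Submodule.span F (encode ξ K '' {a' | a' < a}) →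
    encode ξ K a ∉ Submodule.span F (encode ξ K '' {a' | a' < a})

variable [FiniteDimensional F U] {ξ : ι → Module.Dual F U} {K : ι → Fin b → F}

/-- Greedy argument: the next combination raises the rank unless the earlier ones already span all
`ξ p`. As the `ξ p` separate points they span the dual, whose dimension `≥ b` exceeds the number `k`
of earlier combinations. -/
theorem EncodeGeneric.le_finrank_span (hK : EncodeGeneric ξ K)
    (hξ : ∀ w, (∀ p, ξ p w = 0) → w = 0) (hb : b ≤ Module.finrank F U) (k : ℕ) (hk : k ≤ b) :
    k ≤ Module.finrank F (Submodule.span F (encode ξ K '' {a | a.val < k})) := by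
  induction k with
  | zero => exact Nat.zero_le _
  | succ k ih =>
    have ih := ih (by omega)
    set a : Fin b := ⟨k, hk⟩
    have hset : {a' : Fin b | a'.val < k} = {a' | a' < a} := rfl
    by_cases hex : ∃ p, ξ p ∉ Submodule.span F (encode ξ K '' {a' | a' < a})
    · obtain ⟨p, hp⟩ := hex
      have hlt : Submodule.span F (encode ξ K '' {a' | a'.val < k})
          < Submodule.span F (encode ξ K '' {a' | a'.val < k + 1}) := by
        refine lt_of_le_of_ne (Submodule.span_mono (Set.image_mono fun x hx =>
          Nat.lt_succ_of_lt hx)) fun h => ?_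
        apply hK a p hp
        rw [← hset, h]
        exact Submodule.subset_span ⟨a, Nat.lt_succ_self k, rfl⟩
      have := Submodule.finrank_lt_finrank_of_lt hlt
      omega
    · push Not at hex
      exfalso
      have htop : Submodule.span F (Set.range ξ) = ⊤ := by
        by_contra hne
        obtain ⟨φ, hφ, hle⟩ := Submodule.exists_le_ker_of_lt_top _ (lt_top_iff_ne_top.2 hne)
        apply hφ
        obtain ⟨w, rfl⟩ := (Module.evalEquiv F U).surjective φ
        have : w = 0 := hξ w fun p => by
          have := hle (Submodule.subset_span ⟨p, rfl⟩)
          simpa using this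
        rw [this, map_zero]
      have h1 : Submodule.span F (Set.range ξ)
          ≤ Submodule.span F (encode ξ K '' {a' | a' < a}) := by
        rw [Submodule.span_le]
        rintro _ ⟨p, rfl⟩
        exact hex p
      classical
      have h2 := Submodule.finrank_mono h1
      rw [htop, finrank_top, Subspace.dual_finrank_eq] at h2
      have hfs : ((Finset.univ.filter fun a' : Fin b => a' < a : Finset (Fin b)) : Set (Fin b))
          = {a' | a' < a} := by ext; simp
      have h3 : Module.finrank F (Submodule.span F (encode ξ K '' {a' | a' < a})) ≤ k := by
        rw [← hfs, ← Finset.coe_image]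
        refine (finrank_span_finset_le_card _).trans (Finset.card_image_le.trans ?_)
        have : (Finset.univ.filter fun a' : Fin b => a' < a) = Finset.Iio a := by ext; simp
        rw [this, Fin.card_Iio]
      omega

theorem EncodeGeneric.exists_encode_eq (hK : EncodeGeneric ξ K)
    (hξ : ∀ w, (∀ p, ξ p w = 0) → w = 0) (hb : b ≤ Module.finrank F U) (y : Fin b → F) :
    ∃ w, ∀ a, encode ξ K a w = y a := by
  have hle := hK.le_finrank_span hξ hb b le_rfl
  have hset : encode ξ K '' {a | a.val < b} = Set.range (encode ξ K) := by
    rw [← Set.image_univ]; congr 1; ext a; simp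
  rw [hset] at hle
  have hli : LinearIndependent F (encode ξ K) := by
    rw [linearIndependent_iff_card_le_finrank_span]
    simpa [Set.finrank] using hle
  have hsurj : LinearMap.range (LinearMap.pi (encode ξ K)) = ⊤ := by
    by_contra hne
    obtain ⟨φ, hφ, hker⟩ := Submodule.exists_le_ker_of_lt_top _ (lt_top_iff_ne_top.2 hne)
    apply hφ
    -- A functional vanishing on the joint range is a linear relation among the encoded functionals.
    have h0 : ∑ a, φ (Pi.single a 1) • encode ξ K a = 0 := by
      ext w
      have h1 : φ (LinearMap.pi (encode ξ K) w) = 0 := hker ⟨w, rfl⟩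
      have h2 : ∀ i : Fin b, (fun j => if i = j then (1 : F) else 0) = Pi.single i 1 := by
        intro i; ext j; simp [Pi.single_apply, eq_comm]
      rw [LinearMap.pi_apply_eq_sum_univ φ] at h1
      simpa [mul_comm, h2] using h1
    have h2 := Fintype.linearIndependent_iff.1 hli _ h0
    ext a
    simpa using h2 a
  obtain ⟨w, hw⟩ := LinearMap.range_eq_top.1 hsurj y
  exact ⟨w, fun a => by simpa using congrFun hw a⟩

end Encoding

/-! ### Uniform coins -/

/-- Events of a session up to a given stage depend on finitely many finite-valued data; this makes
them measurable without a σ-algebra on sessions. -/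
theorem measurableSet_of_factors {X Y : Type*} [MeasurableSpace X] [Countable Y] (f : X → Y)
    (hf : ∀ y, MeasurableSet (f ⁻¹' {y})) {B : Set X}
    (hB : ∀ x x', f x = f x' → x ∈ B → x' ∈ B) : MeasurableSet B := by
  have : B = ⋃ y ∈ f '' B, f ⁻¹' {y} := by
    ext x
    simp only [Set.mem_iUnion, Set.mem_preimage, Set.mem_singleton_iff, exists_prop,
      exists_eq_right']
    exact ⟨fun h => ⟨x, h, rfl⟩, fun ⟨x', h, e⟩ => hB x' x e h⟩
  rw [this]
  exact MeasurableSet.biUnion (Set.to_countable _) fun y _ => hf y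

section Coins

variable {F : Type*} [Field F] [Fintype F] [MeasurableSpace F] [DiscreteMeasurableSpace F]

instance : IsProbabilityMeasure (uniformOn (Set.univ : Set F)) :=
  isProbabilityMeasure_uniformOn Set.finite_univ Set.univ_nonempty

instance (ι : Type*) : IsProbabilityMeasure (uniformCoins ι F) := by
  unfold uniformCoins; infer_instance

theorem uniformOn_univ_apply {F : Type*} [Fintype F] [MeasurableSpace F]
    [DiscreteMeasurableSpace F] (A : Set F) :
    uniformOn (Set.univ : Set F) A = (A.ncard : ENNReal) / Fintype.card F := by
  rw [uniformOn, cond_apply MeasurableSet.univ, Set.univ_inter, Measure.count_univ,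
    Measure.count_apply_finite _ (Set.toFinite A), Set.ncard_eq_toFinset_card A (Set.toFinite A),
    mul_comm, ENNReal.div_eq_inv_mul, mul_comm]
  simp

theorem measurePreserving_add_uniformOn (c : F) :
    MeasurePreserving (fun y => y + c) (uniformOn (Set.univ : Set F)) (uniformOn Set.univ) := by
  refine ⟨Measurable.of_discrete, ?_⟩
  ext A hA
  rw [Measure.map_apply Measurable.of_discrete hA, uniformOn_univ_apply, uniformOn_univ_apply]
  congr 2
  exact Set.ncard_preimage_of_injective_subset_range (add_left_injective c)
    (by rw [(add_right_surjective c).range_eq]; exact Set.subset_univ _)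

/-- Adding `c` to the coin with index `i`. -/
def shiftCoin {ι : Type*} [DecidableEq ι] (i : ι) (c : F) (x : ι → F) : ι → F :=
  fun j => if j = i then x j + c else x j

theorem measurePreserving_shiftCoin {ι : Type*} [DecidableEq ι] (i : ι) (c : F) :
    MeasurePreserving (shiftCoin i c) (uniformCoins ι F) (uniformCoins ι F) := by
  have hm : ∀ j, Measurable (fun y : F => if j = i then y + c else y) :=
    fun j => Measurable.of_discrete
  have heq : shiftCoin i c = fun (x : ι → F) j => (fun y : F => if j = i then y + c else y) (x j) :=
    rfl
  refine ⟨by rw [heq]; exact measurable_pi_lambda _ fun j => (hm j).comp (measurable_pi_apply j), ?_⟩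
  rw [heq, uniformCoins, Measure.infinitePi_map_pi _ hm]
  congr 1
  ext1 j
  by_cases h : j = i
  · simp only [h, if_true]
    exact (measurePreserving_add_uniformOn c).map_eq
  · simp only [h, if_false]
    exact Measure.map_id

/-- The preimages of `B` under the shifts are disjoint and equally likely, and there are as many as
field elements. -/
theorem measure_le_inv_card_of_shift {F : Type*} [Fintype F] {X : Type*} [MeasurableSpace X] (ρ : Measure X)
    [IsProbabilityMeasure ρ] (T : F → X → X) (hT : ∀ c, MeasurePreserving (T c) ρ ρ) {B : Set X}
    (hB : MeasurableSet B) (h : ∀ x c c', T c x ∈ B → T c' x ∈ B → c = c') :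
    ρ B ≤ (Fintype.card F : ENNReal)⁻¹ := by
  have h1 : ∑ c, ρ (T c ⁻¹' B) ≤ 1 := by
    rw [← measure_biUnion_finset]
    · exact prob_le_one
    · intro c _ c' _ hne
      rw [Function.onFun, Set.disjoint_left]
      exact fun x hx hx' => hne (h x c c' hx hx')
    · exact fun c _ => (hT c).measurable hB
  have h2 : ∀ c, ρ (T c ⁻¹' B) = ρ B := fun c => (hT c).measure_preimage hB.nullMeasurableSet
  simp only [h2, Finset.sum_const, Finset.card_univ, nsmul_eq_mul] at h1
  rw [ENNReal.le_inv_iff_mul_le, mul_comm]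
  exact h1

theorem uniformCoins_pi {ι : Type*} (J : Finset ι) (A : ι → Set F) :
    uniformCoins ι F {x | ∀ j ∈ J, x j ∈ A j}
      = ∏ j ∈ J, ((A j).ncard : ENNReal) / Fintype.card F := by
  have : {x : ι → F | ∀ j ∈ J, x j ∈ A j} = Set.pi J A := by ext; simp [Set.mem_pi]
  rw [this, uniformCoins, Measure.infinitePi_pi _ fun _ _ => MeasurableSet.of_discrete]
  simp only [uniformOn_univ_apply]

end Coins

/-! ### Decodability for generic public coins -/

section Public

variable {V : Type*} [DecidableEq V] {m b : ℕ} {F : Type*} [Field F]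

theorem Hypernet.sourceRow_congr (g : Hypernet V m) (s : V) {β β' : Fin m → Fin m → F} {e : Fin m}
    (h : ∀ x y, y ≤ e → β x y = β' x y) : g.sourceRow s β e = g.sourceRow s β' e := by
  induction e using WellFoundedLT.induction with
  | _ e ih =>
  rw [sourceRow_eq, sourceRow_eq]
  congr 1
  refine Finset.sum_congr rfl fun x _ => ?_
  split_ifs with hf
  · rw [h x e le_rfl, ih x hf.1 fun x' y hy => h x' y (hy.trans hf.1.le)]
  · rfl

theorem Hypernet.sourceRow_add (g : Hypernet V m) (s : V) {β β' : Fin m → Fin m → F}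
    {e' e : Fin m} (c : F) (hf : g.Feeds s e' e) (h : ∀ x y, y < e → β' x y = β x y)
    (he : ∀ x, x ≠ e' → β' x e = β x e) (hc : β' e' e = β e' e + c) :
    g.sourceRow s β' e = g.sourceRow s β e + c • g.sourceRow s β e' := by
  have hlt : ∀ x, x < e → g.sourceRow s β' x = g.sourceRow s β x := fun x hx =>
    g.sourceRow_congr s fun x' y hy => h x' y (hy.trans_lt hx)
  rw [sourceRow_eq g s β', sourceRow_eq g s β e, add_assoc]
  congr 1
  have : ∀ x, (if g.Feeds s x e then β' x e • g.sourceRow s β' x else 0)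
      = (if g.Feeds s x e then β x e • g.sourceRow s β x else 0)
        + if x = e' then c • g.sourceRow s β x else 0 := by
    intro x
    by_cases hx : x = e'
    · subst hx
      simp only [if_pos hf, if_true, hc, hlt x hf.1, add_smul]
    · simp only [if_neg hx, add_zero]
      split_ifs with hfx
      · rw [he x hx, hlt x hfx.1]
      · rfl
  simp only [this, Finset.sum_add_distrib, Finset.sum_ite_eq', Finset.mem_univ, if_true]

/-- The coordinates of a family of combinations of source symbols that are free of errors. -/
def cleanCoord {N : ℕ} (g : Fin N → Hypernet V m) (s t : V) (β : Fin N → Fin m → Fin m → F)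
    (A : Fin N → Finset (Fin m)) (p : Fin N × Fin m) :
    Module.Dual F (∀ j, (g j).cleanRows s t (β j) (A j)) :=
  LinearMap.proj p.2 ∘ₗ Submodule.subtype _ ∘ₗ LinearMap.proj p.1

/-- All combinations of the packets of the batch are, with suitable coefficients, error-free
combinations of the packets received by `t`. -/
def Decodable {N : ℕ} (g : Fin N → Hypernet V m) (s t : V) (K : Fin N × Fin m → Fin b → F)
    (β : Fin N → Fin m → Fin m → F) (A : Fin N → Finset (Fin m)) : Prop :=
  ∀ y : Fin b → F, ∃ w : Fin N → Fin m → F, (∀ j, w j ∈ (g j).cleanRows s t (β j) (A j)) ∧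
    ∀ a, ∑ p : Fin N × Fin m, K p a * w p.1 p.2 = y a

/-- The clean spaces of the stages have total dimension at least the sum of capacities minus error
cuts, hence at least `b`. Their coordinates separate points, so generic encoding is onto. -/
theorem decodable_of_generic {N : ℕ} {g : Fin N → Hypernet V m} {s t : V}
    {K : Fin N × Fin m → Fin b → F} {β : Fin N → Fin m → Fin m → F} {A : Fin N → Finset (Fin m)}
    (hβ : ∀ j, (g j).Generic s (β j)) (hK : EncodeGeneric (cleanCoord g s t β A) K)
    (hcut : b + ∑ j, (g j).minCut s t (A j) ≤ ∑ j, (g j).capacity s t) :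
    Decodable g s t K β A := by
  intro y
  have hb : b ≤ Module.finrank F (∀ j, (g j).cleanRows s t (β j) (A j)) := by
    rw [Module.finrank_pi_fintype]
    have : ∑ j, (g j).capacity s t ≤ ∑ j, (Module.finrank F ((g j).cleanRows s t (β j) (A j))
        + (g j).minCut s t (A j)) :=
      Finset.sum_le_sum fun j _ => (hβ j).capacity_le_finrank_cleanRows_add t (A j)
    rw [Finset.sum_add_distrib] at this
    omega
  obtain ⟨w, hw⟩ := hK.exists_encode_eq (fun w hw => by
    ext j e; exact hw (j, e)) hb y
  refine ⟨fun j => w j, fun j => (w j).2, fun a => ?_⟩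
  rw [← hw a]
  simp [encode, cleanCoord, LinearMap.sum_apply]

/-- The public coins of the first `N` stages. -/
def publicBlock {F : Type*} (N : ℕ) (x : PublicCoins F m b) :
    (Fin N × Fin m → Fin b → F) × (Fin N → Fin m → Fin m → F) :=
  (fun p a => x.1 (p.1, p.2, a), fun j e' e => x.2 (j, e', e))

variable [Fintype F] [MeasurableSpace F] [DiscreteMeasurableSpace F]

theorem measurable_publicBlock {F : Type*} [MeasurableSpace F] (N : ℕ) :
    Measurable (publicBlock N : PublicCoins F m b → _) := by
  unfold publicBlock
  fun_prop

theorem measurableSet_publicBlock_preimage {F : Type*} [Fintype F] [MeasurableSpace F]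
    [DiscreteMeasurableSpace F] (N : ℕ)
    (B : Set ((Fin N × Fin m → Fin b → F) × (Fin N → Fin m → Fin m → F))) :
    MeasurableSet (publicBlock N ⁻¹' B) :=
  measurable_publicBlock N (Set.to_countable B).measurableSet

/-- The law of the public coins. -/
abbrev publicLaw (F : Type*) [MeasurableSpace F] (m b : ℕ) : Measure (PublicCoins F m b) :=
  (uniformCoins (ℕ × Fin m × Fin b) F).prod (uniformCoins (ℕ × Fin m × Fin m) F)

/-- Varying the coin `β e' e` moves the row of `e` along a line with direction the row of `e'`, and
leaves the rows on `R` fixed since they precede `e`. A line whose direction is outside a subspace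
meets it at most once. -/
theorem measure_not_generic_step_le {N : ℕ} (g : Fin N → Hypernet V m) (s : V) (j : Fin N)
    (e' e : Fin m) (R : Finset (Fin m)) :
    publicLaw F m b (publicBlock N ⁻¹' {x | (g j).Feeds s e' e ∧ (∀ r ∈ R, r < e) ∧
      (g j).sourceRow s (x.2 j) e' ∉ Submodule.span F ((g j).sourceRow s (x.2 j) '' R) ∧
      (g j).sourceRow s (x.2 j) e ∈ Submodule.span F ((g j).sourceRow s (x.2 j) '' R)})
      ≤ (Fintype.card F : ENNReal)⁻¹ := by
  apply measure_le_inv_card_of_shift _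
    (fun c : F => Prod.map id (shiftCoin ((j : ℕ), e', e) c))
    (fun c => (MeasurePreserving.id _).prod (measurePreserving_shiftCoin _ c))
    (measurableSet_publicBlock_preimage N _)
  rintro x c c' ⟨hf, hR, h1, h2⟩ ⟨-, -, -, h4⟩
  have hβ : ∀ (c : F) u v, (publicBlock N
      (Prod.map id (shiftCoin ((j : ℕ), e', e) c) x)).2 j u v
      = if u = e' ∧ v = e then x.2 (j, u, v) + c else x.2 (j, u, v) := by
    intro c u v
    simp [publicBlock, shiftCoin]
  have hlt : ∀ c, ∀ r, r < e → (g j).sourceRow s ((publicBlock N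
      (Prod.map id (shiftCoin ((j : ℕ), e', e) c) x)).2 j) r
      = (g j).sourceRow s ((publicBlock N x).2 j) r := by
    intro c r hr
    refine (g j).sourceRow_congr s fun u v hv => ?_
    rw [hβ, if_neg (fun h => (hv.trans_lt hr).ne h.2)]
    rfl
  have hadd : ∀ c, (g j).sourceRow s ((publicBlock N
      (Prod.map id (shiftCoin ((j : ℕ), e', e) c) x)).2 j) e
      = (g j).sourceRow s ((publicBlock N x).2 j) e
        + c • (g j).sourceRow s ((publicBlock N x).2 j) e' := by
    intro c
    refine (g j).sourceRow_add s c hf ?_ ?_ ?_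
    · intro u v hv
      rw [hβ, if_neg (fun h => hv.ne h.2)]
      rfl
    · intro u hu
      rw [hβ, if_neg (fun h => hu h.1)]
      rfl
    · rw [hβ, if_pos ⟨rfl, rfl⟩]
      rfl
  have hspan : ∀ c, (g j).sourceRow s ((publicBlock N
      (Prod.map id (shiftCoin ((j : ℕ), e', e) c) x)).2 j) '' R
      = (g j).sourceRow s ((publicBlock N x).2 j) '' R := by
    intro c
    exact Set.image_congr fun r hr => hlt c r (hR r hr)
  rw [hspan, hlt c _ hf.1] at h1
  rw [hspan, hadd] at h2 h4
  by_contra hne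
  have h5 := Submodule.sub_mem _ h2 h4
  rw [add_sub_add_left_eq_sub, ← sub_smul] at h5
  exact h1 ((Submodule.smul_mem_iff _ (sub_ne_zero.2 hne)).1 h5)

/-- The same line argument with the coin `K p a`: it moves only the `a`-th combination, in direction
`ξ p`. -/
theorem measure_not_encodeGeneric_step_le {N : ℕ} (g : Fin N → Hypernet V m) (s t : V)
    (A : Fin N → Finset (Fin m)) (a : Fin b) (p : Fin N × Fin m) :
    publicLaw F m b (publicBlock N ⁻¹' {x |
      cleanCoord g s t x.2 A p ∉
        Submodule.span F (encode (cleanCoord g s t x.2 A) x.1 '' {a' | a' < a}) ∧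
      encode (cleanCoord g s t x.2 A) x.1 a ∈
        Submodule.span F (encode (cleanCoord g s t x.2 A) x.1 '' {a' | a' < a})})
      ≤ (Fintype.card F : ENNReal)⁻¹ := by
  apply measure_le_inv_card_of_shift _
    (fun c : F => Prod.map (shiftCoin ((p.1 : ℕ), p.2, a) c) id)
    (fun c => (measurePreserving_shiftCoin _ c).prod (MeasurePreserving.id _))
    (measurableSet_publicBlock_preimage N _)
  rintro x c c' ⟨h1, h2⟩ ⟨-, h4⟩
  -- The clean space depends on the coefficients `β` only, so `ξ` is unaffected by the shift of `K`.
  set ξ := cleanCoord g s t (publicBlock N x).2 A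
  change ξ p ∉ Submodule.span F (encode ξ (publicBlock N
    (Prod.map (shiftCoin ((p.1 : ℕ), p.2, a) c) id x)).1 '' {a' | a' < a}) at h1
  change encode ξ (publicBlock N
    (Prod.map (shiftCoin ((p.1 : ℕ), p.2, a) c) id x)).1 a ∈ Submodule.span F (encode ξ
      (publicBlock N (Prod.map (shiftCoin ((p.1 : ℕ), p.2, a) c) id x)).1 '' {a' | a' < a}) at h2
  change encode ξ (publicBlock N
    (Prod.map (shiftCoin ((p.1 : ℕ), p.2, a) c') id x)).1 a ∈ Submodule.span F (encode ξ
      (publicBlock N (Prod.map (shiftCoin ((p.1 : ℕ), p.2, a) c') id x)).1 '' {a' | a' < a}) at h4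
  have hK : ∀ (c : F) p' a', (publicBlock N
      (Prod.map (shiftCoin ((p.1 : ℕ), p.2, a) c) id x)).1 p' a'
      = (publicBlock N x).1 p' a' + if p' = p ∧ a' = a then c else 0 := by
    intro c p' a'
    have : (p'.1 = p.1 ∧ p'.2 = p.2 ∧ a' = a) ↔ p' = p ∧ a' = a := by
      rw [Prod.ext_iff, and_assoc]
    by_cases h : p' = p ∧ a' = a
    · simp [publicBlock, shiftCoin, h]
    · have h' := h
      rw [← this] at h'
      simp [publicBlock, shiftCoin, Fin.val_inj, h, h']
  have hlt : ∀ (c : F) a', a' < a → encode ξ (publicBlock N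
      (Prod.map (shiftCoin ((p.1 : ℕ), p.2, a) c) id x)).1 a'
      = encode ξ (publicBlock N x).1 a' := by
    intro c a' ha'
    simp only [encode, hK, ha'.ne, and_false, if_false, add_zero]
  have hadd : ∀ (c : F), encode ξ (publicBlock N
      (Prod.map (shiftCoin ((p.1 : ℕ), p.2, a) c) id x)).1 a
      = encode ξ (publicBlock N x).1 a + c • ξ p := by
    intro c
    simp only [encode, hK, and_true, add_smul, Finset.sum_add_distrib, ite_smul, zero_smul,
      Finset.sum_ite_eq', Finset.mem_univ, if_true]
  have hspan : ∀ c : F, encode ξ (publicBlock N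
      (Prod.map (shiftCoin ((p.1 : ℕ), p.2, a) c) id x)).1 '' {a' | a' < a}
      = encode ξ (publicBlock N x).1 '' {a' | a' < a} := by
    intro c
    exact Set.image_congr fun r hr => hlt c r hr
  rw [hspan] at h1
  rw [hspan, hadd] at h2 h4
  by_contra hne
  have h5 := Submodule.sub_mem _ h2 h4
  rw [add_sub_add_left_eq_sub, (sub_smul c c' (ξ p)).symm] at h5
  exact h1 ((Submodule.smul_mem_iff _ (sub_ne_zero.2 hne)).1 h5)

/-- The number of elementary events in which the public coins of `N` stages are not generic. -/
def publicFailures (m b N : ℕ) : ℕ :=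
  Fintype.card (Fin N × Fin m × Fin m × Finset (Fin m))
    + Fintype.card ((Fin N → Finset (Fin m)) × Fin b × Fin N × Fin m)

/-- The quantifier over `A` stands inside the event, so the bound covers a choice of `A` made with
knowledge of the coins. -/
theorem measure_not_decodable_le {N : ℕ} (g : Fin N → Hypernet V m) (s t : V) :
    publicLaw F m b {x | ∃ A : Fin N → Finset (Fin m),
      b + ∑ j, (g j).minCut s t (A j) ≤ ∑ j, (g j).capacity s t ∧
      ¬ Decodable g s t (publicBlock N x).1 (publicBlock N x).2 A}
      ≤ publicFailures m b N * (Fintype.card F : ENNReal)⁻¹ := by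
  have hsub : {x : PublicCoins F m b | ∃ A : Fin N → Finset (Fin m),
      b + ∑ j, (g j).minCut s t (A j) ≤ ∑ j, (g j).capacity s t ∧
      ¬ Decodable g s t (publicBlock N x).1 (publicBlock N x).2 A}
      ⊆ (⋃ i : Fin N × Fin m × Fin m × Finset (Fin m), publicBlock N ⁻¹' {x |
          (g i.1).Feeds s i.2.1 i.2.2.1 ∧ (∀ r ∈ i.2.2.2, r < i.2.2.1) ∧
          (g i.1).sourceRow s (x.2 i.1) i.2.1
            ∉ Submodule.span F ((g i.1).sourceRow s (x.2 i.1) '' i.2.2.2) ∧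
          (g i.1).sourceRow s (x.2 i.1) i.2.2.1
            ∈ Submodule.span F ((g i.1).sourceRow s (x.2 i.1) '' i.2.2.2)}) ∪
        ⋃ i : (Fin N → Finset (Fin m)) × Fin b × Fin N × Fin m, publicBlock N ⁻¹' {x |
          cleanCoord g s t x.2 i.1 i.2.2 ∉
            Submodule.span F (encode (cleanCoord g s t x.2 i.1) x.1 '' {a' | a' < i.2.1}) ∧
          encode (cleanCoord g s t x.2 i.1) x.1 i.2.1 ∈
            Submodule.span F (encode (cleanCoord g s t x.2 i.1) x.1 '' {a' | a' < i.2.1})} := by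
    rintro x ⟨A, hcut, hdec⟩
    by_contra hx
    rw [Set.mem_union, not_or, Set.mem_iUnion, Set.mem_iUnion, not_exists, not_exists] at hx
    refine hdec (decodable_of_generic (fun j e' e R hf hR h1 h2 => ?_) (fun a p h1 h2 => ?_) hcut)
    · exact hx.1 (j, e', e, R) ⟨hf, hR, h1, h2⟩
    · exact hx.2 (A, a, p) ⟨h1, h2⟩
  refine (measure_mono hsub).trans ((measure_union_le _ _).trans ?_)
  rw [publicFailures, Nat.cast_add, add_mul]
  refine add_le_add ?_ ?_
  · refine (measure_iUnion_fintype_le _ _).trans ((Finset.sum_le_card_nsmul _ _ _ fun i _ =>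
      measure_not_generic_step_le g s i.1 i.2.1 i.2.2.1 i.2.2.2).trans ?_)
    rw [nsmul_eq_mul, Finset.card_univ]
  · refine (measure_iUnion_fintype_le _ _).trans ((Finset.sum_le_card_nsmul _ _ _ fun i _ =>
      measure_not_encodeGeneric_step_le g s t i.1 i.2.1 i.2.2).trans ?_)
    rw [nsmul_eq_mul, Finset.card_univ]

end Public

/-! ### Bob's decoding equation in terms of subspaces -/

namespace Session

variable {V F : Type*} [DecidableEq V] [Field F] {m n b : ℕ} (S : Session V F m n b)

/-- The span of the packets that Bob receives in the first `i` stages. -/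
def receivedSpan (i : ℕ) : Submodule F (Fin n ⊕ Fin b → F) :=
  Submodule.span F {v | ∃ j < i, ∃ e, S.dst ∈ (S.net j).heads e ∧ v = S.sent j e}

/-- The packets with vanishing hashes in the first `i` stages. -/
def hashKernel (i : ℕ) : Submodule F (Fin n ⊕ Fin b → F) where
  carrier := {v | ∀ j < i, ∀ k < S.numSecrets j,
    ∑ l, v l * S.r j k ^ ((finSumFinEquiv l : Fin (n + b)).val + 1) = 0}
  zero_mem' := by simp
  add_mem' := fun {v w} hv hw j hj k hk => by
    simp only [Pi.add_apply, add_mul, Finset.sum_add_distrib, hv j hj k hk, hw j hj k hk, add_zero]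
  smul_mem' := fun c v hv j hj k hk => by
    simp only [Pi.smul_apply, smul_eq_mul, mul_assoc, ← Finset.mul_sum, hv j hj k hk, mul_zero]

theorem mem_hashKernel {i : ℕ} {v : Fin n ⊕ Fin b → F} : v ∈ S.hashKernel i ↔
    ∀ j < i, ∀ k < S.numSecrets j,
      ∑ l, v l * S.r j k ^ ((finSumFinEquiv l : Fin (n + b)).val + 1) = 0 := Iff.rfl

theorem range_Y (i : ℕ) : Set.range (S.Y i)
    = {v | ∃ j < i, ∃ e, S.dst ∈ (S.net j).heads e ∧ v = S.sent j e} := by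
  ext v
  constructor
  · rintro ⟨⟨j, e, he⟩, rfl⟩
    exact ⟨j, j.2, e, he, rfl⟩
  · rintro ⟨j, hj, e, he, rfl⟩
    exact ⟨⟨⟨j, hj⟩, e, he⟩, rfl⟩

theorem mul_Y_mem (i : ℕ) (U : Matrix (Fin b) (S.Rows i) F) (a : Fin b) :
    (U * S.Y i) a ∈ S.receivedSpan i := by
  have : (U * S.Y i) a = ∑ p, U a p • S.Y i p := by
    ext l; simp [Matrix.mul_apply]
  rw [this, receivedSpan, ← range_Y]
  exact Submodule.sum_mem _ fun p _ => Submodule.smul_mem _ _ (Submodule.subset_span ⟨p, rfl⟩)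

theorem exists_mul_Y_eq (i : ℕ) (B : Matrix (Fin b) (Fin n ⊕ Fin b) F)
    (hB : ∀ a, B a ∈ S.receivedSpan i) : ∃ U : Matrix (Fin b) (S.Rows i) F, U * S.Y i = B := by
  have : ∀ a, ∃ u : S.Rows i → F, ∑ p, u p • S.Y i p = B a := by
    intro a
    have := hB a
    rw [receivedSpan, ← range_Y] at this
    exact (Submodule.mem_span_range_iff_exists_fun (R := F) (v := fun p => S.Y i p)).1 this
  choose u hu using this
  refine ⟨Matrix.of u, ?_⟩
  ext a l
  have := congrFun (hu a) l
  rw [← this]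
  simp [Matrix.mul_apply]

theorem solves_iff (i : ℕ) (U : Matrix (Fin b) (S.Rows i) F) :
    S.Solves i U ↔ ∀ a, (U * S.Y i) a - S.X₀ a ∈ S.hashKernel i := by
  have h : ∀ (B : Matrix (Fin b) (Fin n ⊕ Fin b) F),
      B * S.D i = S.X₀ * S.D i ↔ ∀ a, B a - S.X₀ a ∈ S.hashKernel i := by
    intro B
    simp only [mem_hashKernel, Pi.sub_apply, sub_mul, Finset.sum_sub_distrib, sub_eq_zero]
    constructor
    · intro h a j hj k hk
      exact congrFun (congrFun h a) ⟨⟨j, hj⟩, ⟨k, hk⟩⟩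
    · intro h
      ext a ⟨j, k⟩
      exact h a j j.2 k k.2
  exact h _

/-- Bob's decoding equation is solvable after `i` stages. -/
def Solvable (i : ℕ) : Prop :=
  ∀ a, ∃ v ∈ S.receivedSpan i, v - S.X₀ a ∈ S.hashKernel i

theorem exists_solves_iff (i : ℕ) : (∃ U, S.Solves i U) ↔ S.Solvable i := by
  constructor
  · rintro ⟨U, hU⟩ a
    exact ⟨_, S.mul_Y_mem i U a, (S.solves_iff i U).1 hU a⟩
  · intro h
    choose B hB hB' using h
    obtain ⟨U, hU⟩ := S.exists_mul_Y_eq i B hB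
    refine ⟨U, (S.solves_iff i U).2 fun a => ?_⟩
    rw [hU]
    exact hB' a

theorem forall_solves_iff (i : ℕ) : (∀ U, S.Solves i U → U * S.Y i = S.X₀) ↔
    ∀ B : Matrix (Fin b) (Fin n ⊕ Fin b) F, (∀ a, B a ∈ S.receivedSpan i) →
      (∀ a, B a - S.X₀ a ∈ S.hashKernel i) → B = S.X₀ := by
  constructor
  · intro h B hB hB'
    obtain ⟨U, rfl⟩ := S.exists_mul_Y_eq i B hB
    exact h U ((S.solves_iff i U).2 hB')
  · intro h U hU
    exact h _ (S.mul_Y_mem i U) ((S.solves_iff i U).1 hU)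

theorem stopsAt_iff (i : ℕ) : S.StopsAt i ↔
    1 ≤ i ∧ S.Solvable i ∧ ∀ j, 1 ≤ j → j < i → ¬ S.Solvable j := by
  simp only [StopsAt, exists_solves_iff]

/-- After `i` stages, every received combination with the same hashes as a packet of the batch is
that packet. -/
def HashFaithful (i : ℕ) : Prop :=
  ∀ a, ∀ v ∈ S.receivedSpan i, v - S.X₀ a ∈ S.hashKernel i → v = S.X₀ a

/-- If the batch is received by stage `N`, the equation is solvable there, so Bob stops by then. He
may stop earlier, which is why faithfulness is needed at all stages up to `N`. -/
theorem exists_decodesAt {N : ℕ} (hN : 1 ≤ N) (hspan : ∀ a, S.X₀ a ∈ S.receivedSpan N)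
    (hhash : ∀ i, 1 ≤ i → i ≤ N → S.HashFaithful i) : ∃ i ≤ N, S.DecodesAt i := by
  classical
  have hex : ∃ i, 1 ≤ i ∧ S.Solvable i :=
    ⟨N, hN, fun a => ⟨_, hspan a, by simp⟩⟩
  have hle : Nat.find hex ≤ N := Nat.find_min' hex ⟨hN, fun a => ⟨_, hspan a, by simp⟩⟩
  refine ⟨Nat.find hex, hle, (S.stopsAt_iff _).2 ⟨(Nat.find_spec hex).1, (Nat.find_spec hex).2,
    fun j hj hlt hs => Nat.find_min hex hlt ⟨hj, hs⟩⟩, ?_⟩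
  rw [forall_solves_iff]
  intro B hB hB'
  funext a
  exact hhash _ (Nat.find_spec hex).1 hle a _ (hB a) (hB' a)

theorem DecodesAt.unique {S : Session V F m n b} {i j : ℕ} (hi : S.DecodesAt i)
    (hj : S.DecodesAt j) : i = j := by
  rcases lt_trichotomy i j with h | h | h
  · exact absurd hi.1.2.1 (hj.1.2.2 i hi.1.1 h)
  · exact h
  · exact absurd hj.1.2.1 (hi.1.2.2 j hj.1.1 h)

theorem rate_eq_of_decodesAt {i : ℕ} (h : S.DecodesAt i) : S.rate = (b : ℝ) / i := by
  have hex : ∃ i, S.DecodesAt i := ⟨i, h⟩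
  rw [rate, dif_pos hex, hex.choose_spec.unique h]

theorem rate_eq_zero (h : ¬ ∃ i, S.DecodesAt i) : S.rate = 0 := by
  rw [rate, dif_neg h]

/-- Two sessions with the same data up to stage `i` agree on what happens until then. -/
theorem receivedSpan_hashKernel_congr {S S' : Session V F m n b} {i : ℕ} (hsrc : S.src = S'.src)
    (hdst : S.dst = S'.dst) (hW : S.W = S'.W) (hnet : ∀ j < i, S.net j = S'.net j)
    (hK : ∀ j < i, S.K j = S'.K j) (hβ : ∀ j < i, S.β j = S'.β j)
    (hr : ∀ j < i, ∀ k < b * m + 1, S.r j k = S'.r j k)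
    (hloc : ∀ j < i, S.loc j = S'.loc j) (herr : ∀ j < i, S.err j = S'.err j) :
    S.receivedSpan i = S'.receivedSpan i ∧ S.hashKernel i = S'.hashKernel i := by
  have hX : S.X₀ = S'.X₀ := by rw [X₀, X₀, hW]
  constructor
  · have hs : ∀ j < i, S.sent j = S'.sent j := by
      intro j hj
      funext e
      rw [sent, sent, hnet j hj, hsrc, hβ j hj, hK j hj, hloc j hj, herr j hj, hX]
    unfold receivedSpan
    congr 1
    ext v
    refine exists_congr fun j => and_congr_right fun hj => ?_
    rw [hs j hj, hnet j hj, hdst]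
  · have hn : ∀ j < i, S.numSecrets j = S'.numSecrets j := by
      intro j hj
      rw [numSecrets, numSecrets, hnet j hj, hsrc]
    -- At most `m` transmissions are Alice's, so finitely many secret symbols per stage matter,
    -- uniformly over the networks.
    have hlt : ∀ j, ∀ k < S'.numSecrets j, k < b * m + 1 := by
      intro j k hk
      have h1 : (S'.net j).opportunities S'.src ≤ m := by
        rw [Hypernet.opportunities]
        simpa using Finset.card_le_univ ((S'.net j).sourceEdges S'.src)
      have h2 := Nat.mul_le_mul_left b h1
      rw [numSecrets] at hk
      split_ifs at hk <;> omega
    ext v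
    rw [mem_hashKernel, mem_hashKernel]
    refine forall_congr' fun j => forall_congr' fun hj => ?_
    rw [hn j hj]
    refine forall_congr' fun k => forall_congr' fun hk => ?_
    rw [hr j hj k (hlt j k hk)]

/-! ### Dimension of the received packets -/

/-- Apply decodability to the unit vector at `a`: the clean weights `w` satisfy `w K = e_a`, so they
turn the sent rows `K X₀` into the row `X₀ a`. -/
theorem X₀_mem_receivedSpan {N : ℕ} (h : Decodable (fun j : Fin N => S.net j) S.src S.dst
      (fun p a => S.K p.1 p.2 a) (fun j : Fin N => S.β j) (fun j => S.loc j)) (a : Fin b) :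
    S.X₀ a ∈ S.receivedSpan N := by
  obtain ⟨w, hw, hwa⟩ := h (Pi.single a 1)
  have hX : S.X₀ a = ∑ j : Fin N, ∑ e,
      w j e • ((S.K j * S.X₀) e : Fin n ⊕ Fin b → F) := by
    have h1 : S.X₀ a = ∑ a', (Pi.single a 1 : Fin b → F) a' • (S.X₀ a' : Fin n ⊕ Fin b → F) := by
      rw [Finset.sum_eq_single a] <;> simp +contextual
    rw [h1]
    simp only [← hwa, Finset.sum_smul]
    rw [Finset.sum_comm, Fintype.sum_prod_type]
    refine Finset.sum_congr rfl fun j _ => Finset.sum_congr rfl fun e _ => ?_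
    ext l
    simp only [Finset.sum_apply, Pi.smul_apply, smul_eq_mul, Matrix.mul_apply, Finset.mul_sum]
    exact Finset.sum_congr rfl fun a' _ => by ring
  rw [hX]
  refine Submodule.sum_mem _ fun j _ => ?_
  refine Submodule.span_mono ?_ (Hypernet.sum_smul_mem_span_packet (hw j) (S.K j * S.X₀) (S.err j))
  rintro _ ⟨e, he, rfl⟩
  exact ⟨j, j.2, e, by simpa using he, rfl⟩

theorem sent_eq (j : ℕ) (e : Fin m) : S.sent j e
    = ∑ e', (S.net j).sourceRow S.src (S.β j) e e' • (S.K j * S.X₀) e'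
      + ∑ e', (S.net j).errorRow S.src (S.β j) (S.loc j) e e' • S.err j e' :=
  (S.net j).packet_eq_rows S.src (S.β j) _ (S.loc j) _ e

/-- The space of the errors received in stage `j`. -/
def errorSpan (j : ℕ) : Submodule F (Fin n ⊕ Fin b → F) :=
  (Submodule.span F ((S.net j).errorRow S.src (S.β j) (S.loc j) '' ((S.net j).received S.dst))).map
    (Fintype.linearCombination F (S.err j))

theorem finrank_errorSpan_le (j : ℕ) :
    Module.finrank F (S.errorSpan j) ≤ (S.net j).minCut S.src S.dst (S.loc j) :=
  (Submodule.finrank_map_le _ _).trans ((S.net j).finrank_span_errorRow_le _ _ _ _)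

/-- The space of the packets sent by the source in the first `i` stages is contained in this
space. -/
def batchSpan (i : ℕ) : Submodule F (Fin n ⊕ Fin b → F) :=
  if ∑ j ∈ Finset.range i, (S.net j).opportunities S.src = 0 then ⊥
  else Submodule.span F (Set.range S.X₀)

theorem receivedSpan_le (i : ℕ) :
    S.receivedSpan i ≤ S.batchSpan i ⊔ ⨆ j : Fin i, S.errorSpan j := by
  rw [receivedSpan, Submodule.span_le]
  rintro _ ⟨j, hj, e, he, rfl⟩
  rw [sent_eq]
  refine Submodule.add_mem_sup ?_ ?_
  · refine Submodule.sum_mem _ fun e' _ => ?_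
    by_cases h : (S.net j).tail e' = S.src
    · refine Submodule.smul_mem _ _ ?_
      rw [batchSpan, if_neg]
      · have : (S.K j * S.X₀) e' = ∑ a, S.K j e' a • S.X₀ a := by
          ext l; simp [Matrix.mul_apply]
        rw [this]
        exact Submodule.sum_mem _ fun a _ =>
          Submodule.smul_mem _ _ (Submodule.subset_span ⟨a, rfl⟩)
      · intro h0
        rw [Finset.sum_eq_zero_iff] at h0
        have := h0 j (Finset.mem_range.2 hj)
        rw [Hypernet.opportunities, Finset.card_eq_zero] at this
        have hmem : e' ∈ (S.net j).sourceEdges S.src := by simp [Hypernet.sourceEdges, h]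
        rw [this] at hmem
        simp at hmem
    · rw [Hypernet.sourceRow_apply_of_tail_ne _ _ _ _ h, zero_smul]
      exact zero_mem _
  · refine Submodule.mem_iSup_of_mem (⟨j, hj⟩ : Fin i) ?_
    refine ⟨_, Submodule.subset_span ⟨e, by simpa using he, rfl⟩, ?_⟩
    exact Fintype.linearCombination_apply F (S.err j) _

theorem _root_.Submodule.finrank_iSup_fin_le {F W : Type*} [Field F] [AddCommGroup W] [Module F W]
    [FiniteDimensional F W] {i : ℕ} (E : Fin i → Submodule F W) :
    Module.finrank F (⨆ j, E j : Submodule F W) ≤ ∑ j, Module.finrank F (E j) := by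
  induction i with
  | zero => simp
  | succ i ih =>
    have h : ⨆ j, E j ≤ E 0 ⊔ ⨆ j : Fin i, E j.succ :=
      iSup_le (Fin.cases le_sup_left fun j =>
        le_sup_of_le_right (le_iSup (fun j : Fin i => E j.succ) j))
    rw [Fin.sum_univ_succ]
    exact (Submodule.finrank_mono h).trans <| (Submodule.finrank_add_le_finrank_add_finrank _ _).trans
      (Nat.add_le_add_left (ih fun j => E j.succ) _)

theorem sum_numSecrets {F : Type*} (S : Session V F m n b) {i : ℕ} (hi : 1 ≤ i) : ∑ j ∈ Finset.range i, S.numSecrets j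
    = b * ∑ j ∈ Finset.range i, (S.net j).opportunities S.src + 1 := by
  simp only [numSecrets, Finset.sum_add_distrib, ← Finset.mul_sum, Finset.sum_ite_eq',
    Finset.mem_range]
  rw [if_pos (by omega)]

/-- This is why `b c + 1` secrets suffice, where `c` counts Alice's transmissions. The batch
contributes at most `b` dimensions and the errors at most `c`. If `c = 0`, only the line of `X₀ a`
remains, and the extra secret pays for it. -/
theorem finrank_receivedSpan_sup_le {i : ℕ} (hi : 1 ≤ i)
    (hcut : ∀ j < i, (S.net j).minCut S.src S.dst (S.loc j) ≤ (S.net j).opportunities S.src)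
    (a : Fin b) :
    Module.finrank F (Submodule.span F {S.X₀ a} ⊔ S.receivedSpan i : Submodule F _)
      ≤ ∑ j ∈ Finset.range i, S.numSecrets j := by
  have hE : Module.finrank F (⨆ j : Fin i, S.errorSpan j : Submodule F _)
      ≤ ∑ j ∈ Finset.range i, (S.net j).opportunities S.src := by
    rw [← Fin.sum_univ_eq_sum_range (fun j => (S.net j).opportunities S.src)]
    exact (Submodule.finrank_iSup_fin_le _).trans (Finset.sum_le_sum fun j _ =>
      (S.finrank_errorSpan_le j).trans (hcut j j.2))
  have hle : Submodule.span F {S.X₀ a} ⊔ S.receivedSpan i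
      ≤ (Submodule.span F {S.X₀ a} ⊔ S.batchSpan i) ⊔ ⨆ j : Fin i, S.errorSpan j := by
    rw [sup_assoc]
    exact sup_le_sup_left (S.receivedSpan_le i) _
  have h1 := (Submodule.finrank_mono hle).trans (Submodule.finrank_add_le_finrank_add_finrank _ _)
  rw [S.sum_numSecrets hi]
  by_cases hc : ∑ j ∈ Finset.range i, (S.net j).opportunities S.src = 0
  · have h2 : Submodule.span F {S.X₀ a} ⊔ S.batchSpan i = Submodule.span F {S.X₀ a} := by
      rw [batchSpan, if_pos hc, sup_bot_eq]
    have h3 : Module.finrank F (Submodule.span F {S.X₀ a}) ≤ 1 := by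
      simpa using finrank_span_le_card (R := F) ({S.X₀ a} : Set (Fin n ⊕ Fin b → F))
    rw [h2] at h1
    omega
  · have h2 : Submodule.span F {S.X₀ a} ⊔ S.batchSpan i = Submodule.span F (Set.range S.X₀) := by
      rw [batchSpan, if_neg hc, sup_eq_right]
      exact Submodule.span_mono (Set.singleton_subset_iff.2 ⟨a, rfl⟩)
    have h3 : Module.finrank F (Submodule.span F (Set.range S.X₀)) ≤ b := by
      simpa [Set.finrank] using finrank_range_le_card (R := F) S.X₀
    rw [h2] at h1
    have hb : 1 ≤ b := a.pos
    have hc' := Nat.one_le_iff_ne_zero.2 hc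
    generalize ∑ j ∈ Finset.range i, (S.net j).opportunities S.src = c at *
    -- `b + c ≤ b * c + 1` amounts to `(b - 1) * (c - 1) ≥ 0`.
    nlinarith

end Session

/-! ### Secret hashes detect errors -/

theorem ncard_roots_le {F ι : Type*} [Field F] [Fintype ι] {d : ℕ} (e : ι ≃ Fin d)
    {v : ι → F} (hv : v ≠ 0) : {y : F | ∑ l, v l * y ^ ((e l).val + 1) = 0}.ncard ≤ d := by
  classical
  let p : Polynomial F := ∑ l, Polynomial.monomial ((e l).val + 1) (v l)
  have hp : p ≠ 0 := by
    intro h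
    apply hv
    funext l
    have h1 : p.coeff ((e l).val + 1) = v l := by
      simp only [p, Polynomial.finsetSum_coeff, Polynomial.coeff_monomial, Nat.add_right_cancel_iff,
        Fin.val_inj, e.injective.eq_iff, Finset.sum_ite_eq', Finset.mem_univ, if_true]
    rw [← h1, h]
    simp
  have hdeg : p.natDegree ≤ d :=
    Polynomial.natDegree_sum_le_of_forall_le _ _ fun l _ =>
      (Polynomial.natDegree_monomial_le _).trans (e l).2
  have hset : {y : F | ∑ l, v l * y ^ ((e l).val + 1) = 0} ⊆ p.roots.toFinset := by
    intro y hy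
    simp only [Finset.mem_coe, Multiset.mem_toFinset, Polynomial.mem_roots hp, Polynomial.IsRoot,
      p, Polynomial.eval_finsetSum, Polynomial.eval_monomial]
    exact hy
  calc _ ≤ (p.roots.toFinset : Set F).ncard := Set.ncard_le_ncard hset (Finset.finite_toSet _)
    _ = p.roots.toFinset.card := Set.ncard_coe_finset _
    _ ≤ _ := (Multiset.toFinset_card_le _).trans ((Polynomial.card_roots' p).trans hdeg)

section Secret

variable {F : Type*} [Field F] [Fintype F] [MeasurableSpace F] [DiscreteMeasurableSpace F]

/-- First moment of the number of nonzero vectors of `E` killed by all hashes: at most `q ^ J.card`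
vectors, each killed with probability at most `(d / q) ^ J.card`. Since killed vectors come with all
their multiples, Markov's inequality at level `q - 1` applies. -/
theorem measure_exists_hash_eq_zero_le {ι κ : Type*} [Fintype ι] {d : ℕ} (e : ι ≃ Fin d)
    (E : Submodule F (ι → F)) (J : Finset κ) (hE : Module.finrank F E ≤ J.card) :
    uniformCoins κ F {y | ∃ v ∈ E, v ≠ 0 ∧ ∀ c ∈ J, ∑ l, v l * y c ^ ((e l).val + 1) = 0}
      ≤ ((2 * d ^ J.card : ℕ) : ENNReal) * (Fintype.card F : ENNReal)⁻¹ := by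
  classical
  set q := Fintype.card F with hq
  have hq1 : 1 < q := Fintype.one_lt_card
  have hq0 : (q : ENNReal) ≠ 0 := by simp; omega
  have hqt : (q : ENNReal) ≠ ⊤ := ENNReal.natCast_ne_top q
  let K : (ι → F) → Set (κ → F) := fun v =>
    {y | ∀ c ∈ J, y c ∈ {z : F | ∑ l, v l * z ^ ((e l).val + 1) = 0}}
  have hKm : ∀ v, MeasurableSet (K v) := by
    intro v
    have : K v = ⋂ c ∈ J, (fun y : κ → F => y c) ⁻¹'
      {z : F | ∑ l, v l * z ^ ((e l).val + 1) = 0} := by ext; simp [K]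
    rw [this]
    exact J.measurableSet_biInter fun c _ => measurable_pi_apply c .of_discrete
  have hKle : ∀ v, v ≠ 0 → uniformCoins κ F (K v) ≤ ((d : ENNReal) / q) ^ J.card := by
    intro v hv
    rw [uniformCoins_pi]
    refine Finset.prod_le_pow_card _ _ _ fun c _ => ?_
    gcongr
    exact_mod_cast ncard_roots_le e hv
  let T : Finset (ι → F) := Finset.univ.filter fun v => v ∈ E ∧ v ≠ 0
  have hTcard : T.card ≤ q ^ J.card := by
    have h1 : T.card ≤ (Finset.univ.filter fun v => v ∈ E).card :=
      Finset.card_le_card fun v hv => by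
        simp only [T, Finset.mem_filter] at hv ⊢
        exact ⟨hv.1, hv.2.1⟩
    have h2 : (Finset.univ.filter fun v => v ∈ E).card = Fintype.card E :=
      (Fintype.card_subtype _).symm
    rw [h2, Module.card_eq_pow_finrank (K := F)] at h1
    exact h1.trans (Nat.pow_le_pow_right (by omega) hE)
  let f : (κ → F) → ENNReal := fun y => ∑ v ∈ T, (K v).indicator 1 y
  have hfm : Measurable f :=
    Finset.measurable_fun_sum _ fun v _ => measurable_one.indicator (hKm v)
  have hf : ∀ y, (∃ v ∈ E, v ≠ 0 ∧ ∀ c ∈ J, ∑ l, v l * y c ^ ((e l).val + 1) = 0) →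
      ((q - 1 : ℕ) : ENNReal) ≤ f y := by
    rintro y ⟨v, hvE, hv0, hv⟩
    let T' : Finset (ι → F) := (Finset.univ.filter fun c : F => c ≠ 0).image fun c => c • v
    have hT' : T'.card = q - 1 := by
      rw [Finset.card_image_of_injective _ (smul_left_injective F hv0), Finset.filter_ne',
        Finset.card_erase_of_mem (Finset.mem_univ _), Finset.card_univ]
    have hsub : T' ⊆ T := by
      intro w hw
      obtain ⟨c, hc, rfl⟩ := Finset.mem_image.1 hw
      exact Finset.mem_filter.2 ⟨Finset.mem_univ _, E.smul_mem c hvE,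
        smul_ne_zero (Finset.mem_filter.1 hc).2 hv0⟩
    calc ((q - 1 : ℕ) : ENNReal) = ∑ v ∈ T', 1 := by simp [hT']
      _ = ∑ v ∈ T', (K v).indicator 1 y := by
        refine Finset.sum_congr rfl fun w hw => ?_
        obtain ⟨c, -, rfl⟩ := Finset.mem_image.1 hw
        rw [Set.indicator_of_mem]
        · rfl
        · intro j hj
          have := hv j hj
          simp only [Set.mem_ofPred_eq, Pi.smul_apply, smul_eq_mul, mul_assoc, ← Finset.mul_sum,
            this, mul_zero]
      _ ≤ f y := Finset.sum_le_sum_of_subset hsub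
  have hint : ∫⁻ y, f y ∂(uniformCoins κ F) ≤ ((d ^ J.card : ℕ) : ENNReal) := by
    rw [lintegral_finsetSum _ fun v _ => measurable_one.indicator (hKm v)]
    simp only [lintegral_indicator_one (hKm _)]
    calc _ ≤ T.card • ((d : ENNReal) / q) ^ J.card :=
          Finset.sum_le_card_nsmul _ _ _ fun v hv => hKle v (Finset.mem_filter.1 hv).2.2
      _ ≤ ((q ^ J.card : ℕ) : ENNReal) * ((d : ENNReal) / q) ^ J.card := by
        rw [nsmul_eq_mul]; gcongr
      _ = ((d ^ J.card : ℕ) : ENNReal) := by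
        rw [Nat.cast_pow, Nat.cast_pow, ← mul_pow, ENNReal.mul_div_cancel hq0 hqt]
  have hmarkov := (mul_meas_ge_le_lintegral (μ := uniformCoins κ F) hfm
    ((q - 1 : ℕ) : ENNReal)).trans hint
  set B := {y : κ → F | ∃ v ∈ E, v ≠ 0 ∧ ∀ c ∈ J, ∑ l, v l * y c ^ ((e l).val + 1) = 0}
  have hB : ((q - 1 : ℕ) : ENNReal) * uniformCoins κ F B ≤ ((d ^ J.card : ℕ) : ENNReal) :=
    le_trans (mul_le_mul_right (measure_mono fun y hy => hf y hy) _) hmarkov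
  -- The factor `2` comes from `q ≤ 2 * (q - 1)`.
  rw [← div_eq_mul_inv, ENNReal.le_div_iff_mul_le (Or.inl hq0) (Or.inl hqt)]
  calc uniformCoins κ F B * q ≤ uniformCoins κ F B * ((2 * (q - 1) : ℕ) : ENNReal) := by
        gcongr; omega
    _ = 2 * (((q - 1 : ℕ) : ENNReal) * uniformCoins κ F B) := by push_cast; ring
    _ ≤ 2 * ((d ^ J.card : ℕ) : ENNReal) := by gcongr
    _ = _ := by push_cast; ring

/-- A false solution differs from some `X₀ a` by a nonzero vector with zero hashes. The subspace
containing it does not depend on the secrets, so the first-moment bound applies for each `a`. -/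
theorem Session.measure_not_hashFaithful_le {V : Type*} [DecidableEq V] {m n b : ℕ}
    (S : Session V F m n b) {i : ℕ} (hi : 1 ≤ i)
    (hcut : ∀ j < i, (S.net j).minCut S.src S.dst (S.loc j) ≤ (S.net j).opportunities S.src) :
    uniformCoins (ℕ × ℕ) F {y | ¬ ({S with r := fun j k => y (j, k)} :
        Session V F m n b).HashFaithful i}
      ≤ ((b * (2 * (n + b) ^ (b * (i * m) + 1)) : ℕ) : ENNReal) * (Fintype.card F : ENNReal)⁻¹ := by
  let J : Finset (ℕ × ℕ) := ((Finset.range i).sigma fun j => Finset.range (S.numSecrets j)).map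
    (Equiv.sigmaEquivProd ℕ ℕ).toEmbedding
  have hJ : J.card = ∑ j ∈ Finset.range i, S.numSecrets j := by
    simp [J]
  have hJle : J.card ≤ b * (i * m) + 1 := by
    rw [hJ, S.sum_numSecrets hi]
    gcongr
    calc _ ≤ ∑ j ∈ Finset.range i, m := Finset.sum_le_sum fun j _ => by
          rw [Hypernet.opportunities]
          simpa using Finset.card_le_univ ((S.net j).sourceEdges S.src)
      _ = i * m := by simp
  have hsub : {y | ¬ ({S with r := fun j k => y (j, k)} : Session V F m n b).HashFaithful i}
      ⊆ ⋃ a : Fin b, {y : ℕ × ℕ → F | ∃ v ∈ Submodule.span F {S.X₀ a} ⊔ S.receivedSpan i, v ≠ 0 ∧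
        ∀ c ∈ J, ∑ l, v l * y c ^ ((finSumFinEquiv l : Fin (n + b)).val + 1) = 0} := by
    intro y hy
    simp only [Set.mem_ofPred_eq, HashFaithful, not_forall] at hy
    obtain ⟨a, v, hv, hk, hne⟩ := hy
    refine Set.mem_iUnion.2 ⟨a, v - S.X₀ a, ?_, sub_ne_zero.2 hne, ?_⟩
    · exact Submodule.sub_mem _ (Submodule.mem_sup_right hv)
        (Submodule.mem_sup_left (Submodule.mem_span_singleton_self _))
    · intro c hc
      have hc' : c.1 < i ∧ c.2 < S.numSecrets c.1 := by
        simp only [J, Finset.mem_map, Finset.mem_sigma, Finset.mem_range] at hc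
        obtain ⟨x, hx, rfl⟩ := hc
        exact hx
      exact hk c.1 hc'.1 c.2 hc'.2
  refine (measure_mono hsub).trans ((measure_iUnion_fintype_le _ _).trans
    ((Finset.sum_le_card_nsmul _ _ _ fun a _ => (measure_exists_hash_eq_zero_le finSumFinEquiv _ J
      ((S.finrank_receivedSpan_sup_le hi hcut a).trans hJ.ge))).trans ?_))
  -- For `b > 0` the base `n + b` is at least one, so raising the exponent to its uniform bound is
  -- monotone.
  rcases Nat.eq_zero_or_pos b with hb | hb
  · simp [hb]
  rw [nsmul_eq_mul, Finset.card_univ, Fintype.card_fin, Nat.cast_mul b, mul_assoc]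
  gcongr
  omega

end Secret

/-! ### The time at which the cut-set condition is met -/

theorem CutSet.cutSetTime_spec {b : ℕ} {M z : ℕ → ℕ} {i : ℕ} (h : CutSet b M z i) :
    CutSet b M z (cutSetTime b M z) :=
  Nat.sInf_mem (s := {i | CutSet b M z i}) ⟨i, h⟩

/-- The hypothesis excludes the default value `0` that `sInf` takes when the condition is never met.
-/
theorem CutSet.lt_cutSetTime_iff {b : ℕ} {M z : ℕ → ℕ} {i : ℕ} (h : CutSet b M z i) {j : ℕ} :
    j < cutSetTime b M z ↔ ∀ k ≤ j, ¬ CutSet b M z k := by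
  constructor
  · intro hj k hk hc
    exact absurd (Nat.sInf_le (s := {i | CutSet b M z i}) hc) (by unfold cutSetTime at hj; omega)
  · intro hj
    by_contra hlt
    exact hj _ (not_lt.1 hlt) h.cutSetTime_spec

theorem cutSetTime_eq_iff {b : ℕ} {M z : ℕ → ℕ} {k : ℕ} : cutSetTime b M z = k ↔
    (CutSet b M z k ∧ ∀ i < k, ¬ CutSet b M z i) ∨ (k = 0 ∧ ∀ i, ¬ CutSet b M z i) := by
  by_cases h : ∃ i, CutSet b M z i
  · obtain ⟨i, hi⟩ := h
    constructor
    · rintro rfl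
      exact Or.inl ⟨hi.cutSetTime_spec, fun i hlt => (hi.lt_cutSetTime_iff.1 hlt) i le_rfl⟩
    · rintro (⟨h1, h2⟩ | ⟨-, h⟩)
      · refine le_antisymm (Nat.sInf_le h1) ?_
        by_contra hlt
        exact h2 _ (not_le.1 hlt) hi.cutSetTime_spec
      · exact absurd hi (h i)
  · push Not at h
    have : {i | CutSet b M z i} = ∅ := by ext i; simp [h i]
    rw [cutSetTime, this, Nat.sInf_empty]
    constructor
    · rintro rfl; exact Or.inr ⟨rfl, h⟩
    · rintro (⟨h1, -⟩ | ⟨h, -⟩)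
      · exact absurd h1 (h k)
      · exact h.symm

/-! ### Drift, Wald's argument and convexity -/

section Renewal

variable {Ω : Type*} [MeasurableSpace Ω] {P : Measure Ω} {b cbar : ℕ} {M z : ℕ → Ω → ℕ}

theorem measurableSet_cutSet (hM : ∀ i, Measurable (M i)) (hz : ∀ i, Measurable (z i)) (i : ℕ) :
    MeasurableSet {ω | CutSet b (M · ω) (z · ω) i} := by
  have h : MeasurableSet {ω | b + ∑ j ∈ Finset.range i, z j ω ≤ ∑ j ∈ Finset.range i, M j ω} :=
    measurableSet_le (measurable_const.add (Finset.measurable_fun_sum _ fun j _ => hz j))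
      (Finset.measurable_fun_sum _ fun j _ => hM j)
  by_cases hi : 1 ≤ i
  · simpa only [CutSet, hi, true_and] using h
  · simp [CutSet, hi]

/-- The event that the cut-set condition has not been met within `j` stages. -/
def unmet (b : ℕ) (M z : ℕ → Ω → ℕ) (j : ℕ) : Set Ω :=
  {ω | ∀ i ≤ j, ¬ CutSet b (M · ω) (z · ω) i}

theorem measurableSet_unmet (hM : ∀ i, Measurable (M i)) (hz : ∀ i, Measurable (z i)) (j : ℕ) :
    MeasurableSet (unmet b M z j) := by
  have : unmet b M z j = ⋂ i ≤ j, {ω | CutSet b (M · ω) (z · ω) i}ᶜ := by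
    ext; simp [unmet]
  rw [this]
  exact MeasurableSet.biInter (Set.to_countable _) fun i _ =>
    (measurableSet_cutSet hM hz i).compl

theorem measurable_cutSetTime (hM : ∀ i, Measurable (M i)) (hz : ∀ i, Measurable (z i)) :
    Measurable fun ω => cutSetTime b (M · ω) (z · ω) := by
  refine measurable_to_countable' fun k => ?_
  have : (fun ω => cutSetTime b (M · ω) (z · ω)) ⁻¹' {k}
      = ({ω | CutSet b (M · ω) (z · ω) k} ∩ ⋂ i < k, {ω | CutSet b (M · ω) (z · ω) i}ᶜ) ∪
        ({ω | k = 0} ∩ ⋂ i, {ω | CutSet b (M · ω) (z · ω) i}ᶜ) := by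
    ext ω
    simp [cutSetTime_eq_iff]
  rw [this]
  refine MeasurableSet.union ?_ ?_
  · exact (measurableSet_cutSet hM hz k).inter (MeasurableSet.biInter (Set.to_countable _)
      fun i _ => (measurableSet_cutSet hM hz i).compl)
  · exact (MeasurableSet.const _).inter
      (MeasurableSet.iInter fun i => (measurableSet_cutSet hM hz i).compl)

/-- As long as the condition fails, the partial sum is at most `b - 1` by integrality. The stage
that first meets it adds at most `cbar`, and later terms vanish. -/
theorem sum_indicator_unmet_le {Ω : Type*} {M z : ℕ → Ω → ℕ} (hb : 0 < b) (hMc : ∀ i ω, M i ω ≤ cbar) (ω : Ω) (k : ℕ) :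
    ∑ j ∈ Finset.range k, (unmet b M z j).indicator (fun ω => (M j ω : ℝ) - z j ω) ω
      ≤ b + cbar - 1 := by
  suffices (ω ∈ unmet b M z k → ∑ j ∈ Finset.range k,
      (unmet b M z j).indicator (fun ω => (M j ω : ℝ) - z j ω) ω
        = ∑ j ∈ Finset.range k, ((M j ω : ℝ) - z j ω) ∧
      ∑ j ∈ Finset.range k, ((M j ω : ℝ) - z j ω) ≤ b - 1) ∧
      ∑ j ∈ Finset.range k, (unmet b M z j).indicator (fun ω => (M j ω : ℝ) - z j ω) ω
        ≤ b + cbar - 1 from this.2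
  have hb' : (1 : ℝ) ≤ b := by exact_mod_cast hb
  have hcb : (0 : ℝ) ≤ cbar := Nat.cast_nonneg _
  induction k with
  | zero => exact ⟨fun _ => ⟨by simp, by simp; linarith⟩, by simp; linarith⟩
  | succ k ih =>
    obtain ⟨ih1, ih2⟩ := ih
    by_cases hk : ω ∈ unmet b M z k
    · obtain ⟨h1, h2⟩ := ih1 hk
      rw [Finset.sum_range_succ, Finset.sum_range_succ, Set.indicator_of_mem hk, h1]
      have h3 : (M k ω : ℝ) ≤ cbar := by exact_mod_cast hMc k ω
      have h4 : (0 : ℝ) ≤ z k ω := Nat.cast_nonneg _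
      refine ⟨fun hk' => ⟨rfl, ?_⟩, by linarith⟩
      have h5 := hk' (k + 1) le_rfl
      rw [CutSet, not_and, not_le] at h5
      have h6 := Nat.succ_le_of_lt (h5 (by omega))
      have h7 : (∑ j ∈ Finset.range (k + 1), (M j ω : ℝ)) + 1
          ≤ b + ∑ j ∈ Finset.range (k + 1), (z j ω : ℝ) := by exact_mod_cast h6
      rw [← Finset.sum_range_succ (fun j => (M j ω : ℝ) - z j ω), Finset.sum_sub_distrib]
      linarith
    · rw [Finset.sum_range_succ, Set.indicator_of_notMem hk, add_zero]
      exact ⟨fun hk' => absurd (fun i hi => hk' i (by omega)) hk, ih2⟩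

variable [IsProbabilityMeasure P]

theorem integrable_natCast_of_le {f : Ω → ℕ} (hf : Measurable f) {c : ℕ} (hc : ∀ ω, f ω ≤ c) :
    Integrable (fun ω => (f ω : ℝ)) P := by
  refine Integrable.of_bound (measurable_from_top.comp hf).aestronglyMeasurable (c : ℝ)
    (Filter.Eventually.of_forall fun ω => ?_)
  rw [Real.norm_natCast]
  exact_mod_cast hc ω

/-- Whether the condition is unmet through `j` involves only the stages with index below `j`, so it
is independent of stage `j`. -/
theorem integral_indicator_unmet
    (hM : ∀ i, Measurable (M i)) (hz : ∀ i, Measurable (z i))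
    (hMc : ∀ i ω, M i ω ≤ cbar) (hzc : ∀ i ω, z i ω ≤ cbar)
    (hindep : iIndepFun (fun i ω => (M i ω, z i ω)) P)
    (hident : ∀ i, IdentDistrib (fun ω => (M i ω, z i ω)) (fun ω => (M 0 ω, z 0 ω)) P P)
    (j : ℕ) :
    ∫ ω, (unmet b M z j).indicator (fun ω => (M j ω : ℝ) - z j ω) ω ∂P
      = P.real (unmet b M z j) * ((∫ ω, (M 0 ω : ℝ) ∂P) - ∫ ω, (z 0 ω : ℝ) ∂P) := by
  classical
  let X : ℕ → Ω → ℕ × ℕ := fun i ω => (M i ω, z i ω)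
  have hX : ∀ i, Measurable (X i) := fun i => (hM i).prodMk (hz i)
  have hind := hindep.indepFun_finset (Finset.range j) {j} (by simp) hX
  -- The default `0` is never read: for `i ≤ j` the sums run over indices below `j`.
  let φ : (Finset.range j → ℕ × ℕ) → ℝ := fun x =>
    if ∀ i ≤ j, ¬ CutSet b (fun k => if h : k ∈ Finset.range j then (x ⟨k, h⟩).1 else 0)
      (fun k => if h : k ∈ Finset.range j then (x ⟨k, h⟩).2 else 0) i then 1 else 0
  let ψ : (({j} : Finset ℕ) → ℕ × ℕ) → ℝ := fun x =>
    ((x ⟨j, by simp⟩).1 : ℝ) - (x ⟨j, by simp⟩).2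
  have hφψ := hind.comp (φ := φ) (ψ := ψ) Measurable.of_discrete Measurable.of_discrete
  have hφ : (φ ∘ fun ω (i : Finset.range j) => X i ω) = (unmet b M z j).indicator 1 := by
    funext ω
    have hcs : ∀ i ≤ j, (CutSet b (fun k => if h : k ∈ Finset.range j then M k ω else 0)
        (fun k => if h : k ∈ Finset.range j then z k ω else 0) i ↔
        CutSet b (M · ω) (z · ω) i) := by
      intro i hi
      unfold CutSet
      have hr : ∀ f : ℕ → Ω → ℕ, ∑ k ∈ Finset.range i,
          (if h : k ∈ Finset.range j then f k ω else 0) = ∑ k ∈ Finset.range i, f k ω := by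
        intro f
        refine Finset.sum_congr rfl fun k hk => dif_pos ?_
        simp only [Finset.mem_range] at *
        omega
      rw [hr, hr]
    by_cases hω : ω ∈ unmet b M z j
    · rw [Set.indicator_of_mem hω]
      exact if_pos fun i hi => (hcs i hi).not.2 (hω i hi)
    · rw [Set.indicator_of_notMem hω]
      exact if_neg fun h => hω fun i hi => (hcs i hi).not.1 (h i hi)
  have hψ : (ψ ∘ fun ω (i : ({j} : Finset ℕ)) => X i ω) = fun ω => (M j ω : ℝ) - z j ω := rfl
  rw [hφ, hψ] at hφψ
  have hmeas := measurableSet_unmet (b := b) hM hz j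
  have hmul := hφψ.integral_fun_mul_eq_mul_integral
    (measurable_one.indicator hmeas).aestronglyMeasurable
    ((integrable_natCast_of_le (hM j) (hMc j)).sub
      (integrable_natCast_of_le (hz j) (hzc j))).aestronglyMeasurable
  have hl : (fun ω => (unmet b M z j).indicator (1 : Ω → ℝ) ω * ((M j ω : ℝ) - z j ω))
      = fun ω => (unmet b M z j).indicator (fun ω => (M j ω : ℝ) - z j ω) ω := by
    funext ω
    by_cases hω : ω ∈ unmet b M z j <;> simp [hω]
  rw [hl] at hmul
  rw [hmul, integral_indicator_one hmeas]
  congr 1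
  have h0 := (hident j).comp (u := fun x : ℕ × ℕ => (x.1 : ℝ) - x.2) Measurable.of_discrete
  have h1 := h0.integral_eq
  simp only [Function.comp_def] at h1
  rw [h1, integral_sub (integrable_natCast_of_le (hM 0) (hMc 0))
    (integrable_natCast_of_le (hz 0) (hzc 0))]

theorem sum_measureReal_unmet_mul_le
    (hM : ∀ i, Measurable (M i)) (hz : ∀ i, Measurable (z i))
    (hMc : ∀ i ω, M i ω ≤ cbar) (hzc : ∀ i ω, z i ω ≤ cbar)
    (hindep : iIndepFun (fun i ω => (M i ω, z i ω)) P)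
    (hident : ∀ i, IdentDistrib (fun ω => (M i ω, z i ω)) (fun ω => (M 0 ω, z 0 ω)) P P)
    (hb : 0 < b) (k : ℕ) :
    (∑ j ∈ Finset.range k, P.real (unmet b M z j)) *
      ((∫ ω, (M 0 ω : ℝ) ∂P) - ∫ ω, (z 0 ω : ℝ) ∂P) ≤ b + cbar - 1 := by
  have hint : ∀ j ∈ Finset.range k,
      Integrable ((unmet b M z j).indicator (fun ω => (M j ω : ℝ) - z j ω)) P := fun j _ =>
    ((integrable_natCast_of_le (hM j) (hMc j)).sub
      (integrable_natCast_of_le (hz j) (hzc j))).indicator (measurableSet_unmet hM hz j)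
  rw [Finset.sum_mul]
  simp only [← integral_indicator_unmet hM hz hMc hzc hindep hident]
  rw [← integral_finsetSum _ hint]
  calc _ ≤ ∫ _, ((b : ℝ) + cbar - 1) ∂P :=
        integral_mono (integrable_finsetSum _ hint) (integrable_const _)
          fun ω => sum_indicator_unmet_le hb hMc ω k
    _ = _ := by simp

theorem ae_exists_cutSet
    (hM : ∀ i, Measurable (M i)) (hz : ∀ i, Measurable (z i))
    (hMc : ∀ i ω, M i ω ≤ cbar) (hzc : ∀ i ω, z i ω ≤ cbar)
    (hindep : iIndepFun (fun i ω => (M i ω, z i ω)) P)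
    (hident : ∀ i, IdentDistrib (fun ω => (M i ω, z i ω)) (fun ω => (M 0 ω, z 0 ω)) P P)
    (hb : 0 < b)
    (hmean : 0 < (∫ ω, (M 0 ω : ℝ) ∂P) - ∫ ω, (z 0 ω : ℝ) ∂P) :
    ∀ᵐ ω ∂P, ∃ i, CutSet b (M · ω) (z · ω) i := by
  set μ := (∫ ω, (M 0 ω : ℝ) ∂P) - ∫ ω, (z 0 ω : ℝ) ∂P
  rw [ae_iff, ← measureReal_eq_zero_iff]
  set A := {ω | ¬ ∃ i, CutSet b (M · ω) (z · ω) i}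
  by_contra hne
  have hpos : 0 < P.real A := lt_of_le_of_ne measureReal_nonneg (Ne.symm hne)
  have hle : ∀ j, P.real A ≤ P.real (unmet b M z j) := fun j =>
    measureReal_mono fun ω hω i _ hi => hω ⟨i, hi⟩
  obtain ⟨k, hk⟩ := exists_nat_gt (((b : ℝ) + cbar - 1) / (P.real A * μ))
  rw [div_lt_iff₀ (by positivity)] at hk
  have h1 := sum_measureReal_unmet_mul_le hM hz hMc hzc hindep hident hb k
  have h2 : (k : ℝ) * P.real A ≤ ∑ j ∈ Finset.range k, P.real (unmet b M z j) := by
    simpa using Finset.card_nsmul_le_sum (Finset.range k) _ _ fun j _ => hle j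
  have h3 := mul_le_mul_of_nonneg_right h2 hmean.le
  linarith

theorem integrable_div_cutSetTime (hM : ∀ i, Measurable (M i)) (hz : ∀ i, Measurable (z i)) :
    Integrable (fun ω => (b : ℝ) / (cutSetTime b (M · ω) (z · ω) : ℝ)) P := by
  refine Integrable.of_bound ((measurable_from_top (f := fun k : ℕ => (b : ℝ) / k)).comp
    (measurable_cutSetTime hM hz)).aestronglyMeasurable (b : ℝ)
    (Filter.Eventually.of_forall fun ω => ?_)
  rw [Real.norm_of_nonneg (by positivity)]
  rcases Nat.eq_zero_or_pos (cutSetTime b (M · ω) (z · ω)) with h | h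
  · rw [h]; simp
  · exact div_le_self (by positivity) (by exact_mod_cast h)

/-- Jensen's inequality for `1/x`, carried out with the tangent at `a`. Only truncated means are
bounded directly, so `N` is replaced by `min N k` at a cost of `1 / k`, and then `k → ∞`. -/
theorem le_integral_div_cutSetTime
    (hM : ∀ i, Measurable (M i)) (hz : ∀ i, Measurable (z i))
    (hMc : ∀ i ω, M i ω ≤ cbar) (hzc : ∀ i ω, z i ω ≤ cbar)
    (hindep : iIndepFun (fun i ω => (M i ω, z i ω)) P)
    (hident : ∀ i, IdentDistrib (fun ω => (M i ω, z i ω)) (fun ω => (M 0 ω, z 0 ω)) P P)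
    (hb : 0 < b)
    (hmean : 0 < (∫ ω, (M 0 ω : ℝ) ∂P) - ∫ ω, (z 0 ω : ℝ) ∂P) :
    (b : ℝ) / ((b : ℝ) + cbar - 1) * ((∫ ω, (M 0 ω : ℝ) ∂P) - ∫ ω, (z 0 ω : ℝ) ∂P) ≤
      ∫ ω, (b : ℝ) / (cutSetTime b (M · ω) (z · ω) : ℝ) ∂P := by
  have hae := ae_exists_cutSet hM hz hMc hzc hindep hident hb hmean
  have hsum := fun k => sum_measureReal_unmet_mul_le hM hz hMc hzc hindep hident hb k
  set μ := (∫ ω, (M 0 ω : ℝ) ∂P) - ∫ ω, (z 0 ω : ℝ) ∂P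
  have hbpos : (0 : ℝ) < b := by exact_mod_cast hb
  -- With `k = 1` the drift inequality reads `μ ≤ b + cbar - 1`, because nothing is met after zero
  -- stages.
  have hapos : (0 : ℝ) < b + cbar - 1 := by
    have h1 := hsum 1
    have h0 : unmet b M z 0 = Set.univ := by
      ext ω; simp [unmet, CutSet]
    rw [Finset.sum_range_one, h0, probReal_univ, one_mul] at h1
    linarith
  set a := ((b : ℝ) + cbar - 1) / μ with ha
  have ha0 : 0 < a := by positivity
  have hint := integrable_div_cutSetTime (P := P) (b := b) hM hz
  have hlow : ∀ k : ℕ, 0 < k → b * (1 / a - 1 / k) ≤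
      ∫ ω, (b : ℝ) / (cutSetTime b (M · ω) (z · ω) : ℝ) ∂P := by
    intro k hk
    have hk' : (0 : ℝ) < k := by exact_mod_cast hk
    have hind : ∀ j ∈ Finset.range k, Integrable ((unmet b M z j).indicator (1 : Ω → ℝ)) P :=
      fun j _ => (integrable_const (1 : ℝ)).indicator (measurableSet_unmet hM hz j)
    have hpt : ∀ᵐ ω ∂P, (b : ℝ) * (2 / a - 1 / k
        - (∑ j ∈ Finset.range k, (unmet b M z j).indicator (1 : Ω → ℝ) ω) / a ^ 2)
        ≤ (b : ℝ) / (cutSetTime b (M · ω) (z · ω) : ℝ) := by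
      filter_upwards [hae] with ω ⟨i, hi⟩
      set N := cutSetTime b (M · ω) (z · ω) with hN
      have hN1 : 1 ≤ N := hi.cutSetTime_spec.1
      have hcount : ∑ j ∈ Finset.range k, (unmet b M z j).indicator (1 : Ω → ℝ) ω
          = (min N k : ℕ) := by
        have h1 : ∀ j, (unmet b M z j).indicator (1 : Ω → ℝ) ω = if j < N then 1 else 0 := by
          intro j
          by_cases hj : j < N
          · rw [if_pos hj, Set.indicator_of_mem (show ω ∈ unmet b M z j from hi.lt_cutSetTime_iff.1 hj)]; rfl
          · rw [if_neg hj, Set.indicator_of_notMem fun h : ω ∈ unmet b M z j => hj (hi.lt_cutSetTime_iff.2 h)]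
        simp only [h1, Finset.sum_boole]
        congr 1
        have : (Finset.range k).filter (fun j => j < N) = Finset.range (min N k) := by
          ext j; simp [and_comm]
        rw [this, Finset.card_range]
      rw [hcount, div_eq_mul_one_div (b : ℝ)]
      gcongr
      have hxpos : (0 : ℝ) < (min N k : ℕ) := by exact_mod_cast lt_min hN1 hk
      have hNpos : (0 : ℝ) < N := by exact_mod_cast hN1
      -- The graph of `1/x` lies above its tangent at `a`; the gap is a square over a positive
      -- number.
      have h1 : 2 / a - ((min N k : ℕ) : ℝ) / a ^ 2 ≤ 1 / ((min N k : ℕ) : ℝ) := by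
        generalize ((min N k : ℕ) : ℝ) = x at hxpos
        have : 1 / x - (2 / a - x / a ^ 2) = (a - x) ^ 2 / (a ^ 2 * x) := by
          field_simp; ring
        have h2 : 0 ≤ (a - x) ^ 2 / (a ^ 2 * x) := by positivity
        linarith
      have h2 : 1 / ((min N k : ℕ) : ℝ) ≤ 1 / N + 1 / k := by
        rcases min_choice N k with h | h <;> rw [h]
        · have : (0 : ℝ) ≤ 1 / k := by positivity
          linarith
        · have : (0 : ℝ) ≤ 1 / N := by positivity
          linarith
      linarith
    have hmono := integral_mono_ae ?_ hint hpt
    swap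
    · exact ((integrable_const _).sub
        ((integrable_finsetSum _ hind).div_const _)).const_mul _
    refine le_trans ?_ hmono
    rw [integral_const_mul, integral_sub (integrable_const _)
      ((integrable_finsetSum _ hind).div_const _), integral_div, integral_finsetSum _ hind]
    simp only [integral_indicator_one (measurableSet_unmet (b := b) hM hz _), integral_const,
      probReal_univ, one_smul]
    refine mul_le_mul_of_nonneg_left ?_ hbpos.le
    have h1 : ∑ j ∈ Finset.range k, P.real (unmet b M z j) ≤ a := by
      rw [ha, le_div_iff₀ hmean]
      exact hsum k
    have h2 : (∑ j ∈ Finset.range k, P.real (unmet b M z j)) / a ^ 2 ≤ a / a ^ 2 := by gcongr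
    have h3 : a / a ^ 2 = 1 / a := by field_simp
    have h4 : 2 / a = 1 / a + 1 / a := by ring
    linarith
  have hlim : Filter.Tendsto (fun k : ℕ => (b : ℝ) * (1 / a - 1 / k)) Filter.atTop
      (nhds (b * (1 / a - 0))) :=
    (tendsto_const_nhds.sub tendsto_one_div_atTop_nhds_zero_nat).const_mul _
  have hfin := le_of_tendsto hlim (Filter.eventually_atTop.2 ⟨1, fun k hk => hlow k hk⟩)
  refine le_trans (le_of_eq ?_) hfin
  rw [ha]
  field_simp
  ring

end Renewal

/-! ### Events of a session -/

instance {V : Type*} [Finite V] {m : ℕ} : Finite (Hypernet V m) :=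
  Finite.of_injective (fun g => (g.tail, g.heads)) fun g g' h => by
    cases g; cases g'; simpa using h

namespace Session

variable {V F : Type*} [DecidableEq V] [Field F] {m n b : ℕ}

/-- The sessions agree in the first `i` stages. -/
structure AgreeUpTo (i : ℕ) (S S' : Session V F m n b) : Prop where
  src : S.src = S'.src
  dst : S.dst = S'.dst
  W : S.W = S'.W
  net : ∀ j < i, S.net j = S'.net j
  K : ∀ j < i, S.K j = S'.K j
  β : ∀ j < i, S.β j = S'.β j
  r : ∀ j < i, ∀ k < b * m + 1, S.r j k = S'.r j k
  loc : ∀ j < i, S.loc j = S'.loc j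
  err : ∀ j < i, S.err j = S'.err j

variable {S S' : Session V F m n b} {i : ℕ}

theorem AgreeUpTo.X₀_eq {V : Type*} {S S' : Session V F m n b} (h : AgreeUpTo i S S') : S.X₀ = S'.X₀ := by rw [X₀, X₀, h.W]

theorem AgreeUpTo.receivedSpan_eq (h : AgreeUpTo i S S') {j : ℕ} (hj : j ≤ i) :
    S.receivedSpan j = S'.receivedSpan j :=
  (receivedSpan_hashKernel_congr h.src h.dst h.W (fun k hk => h.net k (hk.trans_le hj))
    (fun k hk => h.K k (hk.trans_le hj)) (fun k hk => h.β k (hk.trans_le hj))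
    (fun k hk => h.r k (hk.trans_le hj)) (fun k hk => h.loc k (hk.trans_le hj))
    (fun k hk => h.err k (hk.trans_le hj))).1

theorem AgreeUpTo.hashKernel_eq (h : AgreeUpTo i S S') {j : ℕ} (hj : j ≤ i) :
    S.hashKernel j = S'.hashKernel j :=
  (receivedSpan_hashKernel_congr h.src h.dst h.W (fun k hk => h.net k (hk.trans_le hj))
    (fun k hk => h.K k (hk.trans_le hj)) (fun k hk => h.β k (hk.trans_le hj))
    (fun k hk => h.r k (hk.trans_le hj)) (fun k hk => h.loc k (hk.trans_le hj))
    (fun k hk => h.err k (hk.trans_le hj))).2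

theorem AgreeUpTo.solvable_iff (h : AgreeUpTo i S S') {j : ℕ} (hj : j ≤ i) :
    S.Solvable j ↔ S'.Solvable j := by
  rw [Solvable, Solvable, h.receivedSpan_eq hj, h.hashKernel_eq hj, h.X₀_eq]

theorem AgreeUpTo.hashFaithful_iff (h : AgreeUpTo i S S') :
    S.HashFaithful i ↔ S'.HashFaithful i := by
  rw [HashFaithful, HashFaithful, h.receivedSpan_eq le_rfl, h.hashKernel_eq le_rfl, h.X₀_eq]

theorem AgreeUpTo.decodesAt_iff (h : AgreeUpTo i S S') : S.DecodesAt i ↔ S'.DecodesAt i := by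
  rw [DecodesAt, DecodesAt, stopsAt_iff, stopsAt_iff, forall_solves_iff, forall_solves_iff,
    h.receivedSpan_eq le_rfl, h.hashKernel_eq le_rfl, h.X₀_eq, h.solvable_iff le_rfl]
  refine and_congr_left fun _ => and_congr_right fun _ => and_congr_right fun _ => ?_
  exact forall_congr' fun j => forall_congr' fun _ => forall_congr' fun hj =>
    (h.solvable_iff hj.le).not

end Session

/-! ### Measurability and probability of the bad events -/

section Events

variable {V : Type*} [Fintype V] [DecidableEq V] {s t : V} {m n b : ℕ} {Ω : Type*}
  [MeasurableSpace Ω] {G : ℕ → Ω → Hypernet V m} {F : Type*} [Field F] [Fintype F]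
  [MeasurableSpace F] [DiscreteMeasurableSpace F] (W : Matrix (Fin b) (Fin n) F)
  (adv : Adversary Ω F m n b)

theorem measurableSet_session {V F : Type*} [Fintype V] [Fintype F] [MeasurableSpace F]
    [DiscreteMeasurableSpace F] {s t : V} {G : ℕ → Ω → Hypernet V m}
    (W : Matrix (Fin b) (Fin n) F) (adv : Adversary Ω F m n b) (hG : ∀ i g, MeasurableSet {ω | G i ω = g})
    {p : Session V F m n b → Prop} (i : ℕ)
    (hp : ∀ S S' : Session V F m n b, S.AgreeUpTo i S' → (p S ↔ p S')) :
    MeasurableSet {x | p (session s t G W adv x)} := by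
  let f : (Ω × PublicCoins F m b) × SecretCoins F → (Fin i → Hypernet V m) ×
      (Fin i × Fin m × Fin b → F) × (Fin i × Fin m × Fin m → F) × (Fin i × Fin (b * m + 1) → F) ×
      (Fin i → Finset (Fin m)) × (Fin i → Matrix (Fin m) (Fin n ⊕ Fin b) F) := fun x =>
    (fun j => G j x.1.1, fun c => x.1.2.1 (c.1, c.2), fun c => x.1.2.2 (c.1, c.2),
      fun c => x.2 (c.1, c.2), fun j => adv.loc j x.1, fun j => adv.err j x.1)
  have : Finite (Matrix (Fin m) (Fin n ⊕ Fin b) F) :=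
    inferInstanceAs (Finite (Fin m → Fin n ⊕ Fin b → F))
  refine measurableSet_of_factors f (fun y => ?_) fun x x' h hx => (hp _ _ ?_).1 hx
  · have heq : f ⁻¹' {y} = (⋂ j : Fin i, (fun x => x.1.1) ⁻¹' {ω | G j ω = y.1 j}) ∩
        ((⋂ c, (fun x => x.1.2.1 (c.1, c.2)) ⁻¹' {y.2.1 c}) ∩
        ((⋂ c, (fun x => x.1.2.2 (c.1, c.2)) ⁻¹' {y.2.2.1 c}) ∩
        ((⋂ c, (fun x => x.2 (c.1, c.2)) ⁻¹' {y.2.2.2.1 c}) ∩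
        ((⋂ j : Fin i, (fun x => x.1) ⁻¹' {x | adv.loc j x = y.2.2.2.2.1 j}) ∩
        (⋂ j : Fin i, (fun x => x.1) ⁻¹' {x | adv.err j x = y.2.2.2.2.2 j}))))) := by
      ext x
      simp only [Set.mem_preimage, Set.mem_singleton_iff, f, Prod.ext_iff, funext_iff,
        Set.mem_inter_iff, Set.mem_iInter, Set.mem_ofPred_eq]
    rw [heq]
    refine .inter (.iInter fun j => ?_) <| .inter (.iInter fun c => ?_) <|
      .inter (.iInter fun c => ?_) <| .inter (.iInter fun c => ?_) <|
      .inter (.iInter fun j => ?_) (.iInter fun j => ?_)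
    · exact measurable_fst.fst (hG j _)
    · exact (measurable_pi_apply _).comp measurable_fst.snd.fst (measurableSet_singleton _)
    · exact (measurable_pi_apply _).comp measurable_fst.snd.snd (measurableSet_singleton _)
    · exact (measurable_pi_apply _).comp measurable_snd (measurableSet_singleton _)
    · exact measurable_fst (adv.measurable_loc j _)
    · exact measurable_fst (adv.measurable_err j _)
  · simp only [f, Prod.ext_iff, funext_iff] at h
    obtain ⟨h1, h2, h3, h4, h5, h6⟩ := h
    exact
      { src := rfl
        dst := rfl
        W := rfl
        net := fun j hj => h1 ⟨j, hj⟩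
        K := fun j hj => by ext e k; exact h2 (⟨j, hj⟩, e, k)
        β := fun j hj => by ext e e'; exact h3 (⟨j, hj⟩, e, e')
        r := fun j hj k hk => h4 (⟨j, hj⟩, ⟨k, hk⟩)
        loc := fun j hj => h5 ⟨j, hj⟩
        err := fun j hj => h6 ⟨j, hj⟩ }

theorem measure_prod_le_of_forall {X Y : Type*} [MeasurableSpace X] [MeasurableSpace Y]
    (μ : Measure X) [IsProbabilityMeasure μ] (ν : Measure Y) [SFinite ν] {B : Set (X × Y)}
    (hB : MeasurableSet B) {c : ENNReal} (h : ∀ x, ν (Prod.mk x ⁻¹' B) ≤ c) : μ.prod ν B ≤ c := by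
  rw [Measure.prod_apply hB]
  calc _ ≤ ∫⁻ _, c ∂μ := lintegral_mono h
    _ = c := by simp

variable {P : Measure Ω} [IsProbabilityMeasure P]

instance : IsProbabilityMeasure (jointLaw P F m b) := by
  unfold jointLaw; infer_instance

variable {M z : ℕ → Ω → ℕ}

/-- The event that the cut-set condition holds after `k` stages, and yet the batch is not a
combination of the packets received by then. -/
def missing (s t : V) (G : ℕ → Ω → Hypernet V m) (M z : ℕ → Ω → ℕ)
    (W : Matrix (Fin b) (Fin n) F) (adv : Adversary Ω F m n b) (k : ℕ) :
    Set ((Ω × PublicCoins F m b) × SecretCoins F) :=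
  {x | CutSet b (M · x.1.1) (z · x.1.1) k} ∩
    {x | ¬ ∀ a, (session s t G W adv x).X₀ a ∈ (session s t G W adv x).receivedSpan k}

/-- The event that a false solution of the decoding equation exists after `i` stages. -/
def deceived (s t : V) (G : ℕ → Ω → Hypernet V m) (W : Matrix (Fin b) (Fin n) F)
    (adv : Adversary Ω F m n b) (i : ℕ) : Set ((Ω × PublicCoins F m b) × SecretCoins F) :=
  {x | 1 ≤ i ∧ ¬ (session s t G W adv x).HashFaithful i}

theorem measurableSet_deceived (hG : ∀ i g, MeasurableSet {ω | G i ω = g}) (i : ℕ) :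
    MeasurableSet (deceived s t G W adv i) :=
  measurableSet_session W adv hG i (p := fun S => 1 ≤ i ∧ ¬ S.HashFaithful i)
    fun _ _ h => and_congr_right fun _ => h.hashFaithful_iff.not

theorem measurableSet_missing (hG : ∀ i g, MeasurableSet {ω | G i ω = g})
    (hM : ∀ i, Measurable (M i)) (hz : ∀ i, Measurable (z i)) (k : ℕ) :
    MeasurableSet (missing s t G M z W adv k) := by
  refine (measurable_fst.fst (measurableSet_cutSet hM hz k)).inter ?_
  refine measurableSet_session W adv hG k
    (p := fun S => ¬ ∀ a, S.X₀ a ∈ S.receivedSpan k) fun S S' h => ?_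
  rw [h.X₀_eq, h.receivedSpan_eq le_rfl]

theorem jointLaw_missing_le (hG : ∀ i g, MeasurableSet {ω | G i ω = g})
    (hMm : ∀ i, Measurable (M i)) (hz : ∀ i, Measurable (z i))
    (hM : ∀ i ω, M i ω = (G i ω).capacity s t)
    (hadv : ∀ i x, (G i x.1).minCut s t (adv.loc i x) ≤ z i x.1) (k : ℕ) :
    jointLaw P F m b (missing s t G M z W adv k)
      ≤ publicFailures m b k * (Fintype.card F : ENNReal)⁻¹ := by
  have hmeas := measurableSet_missing (s := s) (t := t) W adv hG hMm hz k
  -- Missing the batch does not involve the secret coins, so they may be set to `0`.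
  let A : Set (Ω × PublicCoins F m b) := (fun x => (x, 0)) ⁻¹' missing s t G M z W adv k
  have hA : MeasurableSet A := measurable_prodMk_right hmeas
  have hpre : missing s t G M z W adv k = Prod.fst ⁻¹' A := rfl
  rw [hpre, jointLaw, measurePreserving_fst.measure_preimage hA.nullMeasurableSet]
  refine measure_prod_le_of_forall _ _ hA fun ω => ?_
  refine (measure_mono ?_).trans
    (measure_not_decodable_le (N := k) (fun j : Fin k => G j ω) s t)
  rintro x ⟨hcut, hx⟩
  refine ⟨fun j => adv.loc j (ω, x), ?_, fun hdec => hx fun a => ?_⟩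
  · have h1 : b + ∑ j ∈ Finset.range k, z j ω ≤ ∑ j ∈ Finset.range k, M j ω := hcut.2
    rw [← Fin.sum_univ_eq_sum_range (fun j => z j ω),
      ← Fin.sum_univ_eq_sum_range (fun j => M j ω)] at h1
    simp only [hM] at h1
    refine le_trans ?_ h1
    gcongr with j
    exact hadv j (ω, x)
  · exact (session s t G W adv ((ω, x), 0)).X₀_mem_receivedSpan (N := k) hdec a

/-- Condition on the world and the public coins: Calvin's errors are then fixed, while the secrets
remain uniform. -/
theorem jointLaw_deceived_le (hG : ∀ i g, MeasurableSet {ω | G i ω = g})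
    (hzc : ∀ i ω, z i ω ≤ (G i ω).opportunities s)
    (hadv : ∀ i x, (G i x.1).minCut s t (adv.loc i x) ≤ z i x.1) (i : ℕ) :
    jointLaw P F m b (deceived s t G W adv i)
      ≤ ((b * (2 * (n + b) ^ (b * (i * m) + 1)) : ℕ) : ENNReal)
        * (Fintype.card F : ENNReal)⁻¹ := by
  rw [jointLaw]
  refine measure_prod_le_of_forall _ _ (measurableSet_deceived W adv hG i) fun x => ?_
  by_cases hi : 1 ≤ i
  · have h := (session s t G W adv (x, fun _ => 0)).measure_not_hashFaithful_le hi
      fun j _ => le_trans (hadv j x) (hzc j x.1)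
    refine le_trans (measure_mono ?_) h
    rintro y ⟨-, hy⟩
    exact hy
  · refine le_of_eq_of_le ?_ zero_le
    have : Prod.mk x ⁻¹' deceived s t G W adv i = ∅ := by
      ext y; simp [deceived, hi]
    rw [this, measure_empty]

/-- A bound, up to the factor `1 / q`, on the probability that decoding goes wrong although the
cut-set condition is met within `N` stages. -/
def failureConstant (m n b N : ℕ) : ℕ :=
  ∑ k ∈ Finset.range (N + 1), (publicFailures m b k + b * (2 * (n + b) ^ (b * (k * m) + 1)))

/-- The event that the cut-set condition is not met within `N` stages, or that decoding may go
wrong. -/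
def failure (s t : V) (G : ℕ → Ω → Hypernet V m) (M z : ℕ → Ω → ℕ)
    (W : Matrix (Fin b) (Fin n) F) (adv : Adversary Ω F m n b) (N : ℕ) :
    Set ((Ω × PublicCoins F m b) × SecretCoins F) :=
  (fun x => x.1.1) ⁻¹' unmet b M z N ∪
    ⋃ k ∈ Finset.range (N + 1), (missing s t G M z W adv k ∪ deceived s t G W adv k)

theorem measurableSet_failure (hG : ∀ i g, MeasurableSet {ω | G i ω = g})
    (hM : ∀ i, Measurable (M i)) (hz : ∀ i, Measurable (z i)) (N : ℕ) :
    MeasurableSet (failure s t G M z W adv N) :=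
  (measurable_fst.fst (measurableSet_unmet hM hz N)).union <|
    Finset.measurableSet_biUnion _ fun k _ =>
      (measurableSet_missing W adv hG hM hz k).union (measurableSet_deceived W adv hG k)

theorem jointLaw_failure_le (hG : ∀ i g, MeasurableSet {ω | G i ω = g})
    (hMm : ∀ i, Measurable (M i)) (hz : ∀ i, Measurable (z i))
    (hM : ∀ i ω, M i ω = (G i ω).capacity s t)
    (hzc : ∀ i ω, z i ω ≤ (G i ω).opportunities s)
    (hadv : ∀ i x, (G i x.1).minCut s t (adv.loc i x) ≤ z i x.1) (N : ℕ) :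
    (jointLaw P F m b).real (failure s t G M z W adv N)
      ≤ P.real (unmet b M z N) + failureConstant m n b N / Fintype.card F := by
  have hfst : MeasurePreserving (fun x : (Ω × PublicCoins F m b) × SecretCoins F => x.1.1)
      (jointLaw P F m b) P := measurePreserving_fst.comp measurePreserving_fst
  have hle : jointLaw P F m b (failure s t G M z W adv N)
      ≤ P (unmet b M z N) + failureConstant m n b N * (Fintype.card F : ENNReal)⁻¹ := by
    refine (measure_union_le _ _).trans (add_le_add ?_ ?_)
    · rw [hfst.measure_preimage (measurableSet_unmet hMm hz N).nullMeasurableSet]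
    · refine (measure_biUnion_finset_le _ _).trans ?_
      rw [failureConstant, Nat.cast_sum, Finset.sum_mul]
      refine Finset.sum_le_sum fun k _ => (measure_union_le _ _).trans ?_
      rw [Nat.cast_add, add_mul]
      exact add_le_add (jointLaw_missing_le W adv hG hMm hz hM hadv k)
        (jointLaw_deceived_le W adv hG hzc hadv k)
  have hq : (Fintype.card F : ENNReal) ≠ 0 := by simp
  have hfin : (failureConstant m n b N * (Fintype.card F : ENNReal)⁻¹) ≠ ⊤ :=
    ENNReal.mul_ne_top (ENNReal.natCast_ne_top _) (ENNReal.inv_ne_top.2 hq)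
  have := ENNReal.toReal_mono (ENNReal.add_ne_top.2 ⟨measure_ne_top _ _, hfin⟩) hle
  rw [ENNReal.toReal_add (measure_ne_top _ _) hfin, ENNReal.toReal_mul, ENNReal.toReal_inv,
    ENNReal.toReal_natCast, ENNReal.toReal_natCast] at this
  exact this

theorem exists_decodesAt_of_notMem_failure {V F : Type*} [DecidableEq V] [Field F]
    [MeasurableSpace F] {s t : V} {G : ℕ → Ω → Hypernet V m} {W : Matrix (Fin b) (Fin n) F}
    {adv : Adversary Ω F m n b} {N : ℕ} {x : (Ω × PublicCoins F m b) × SecretCoins F}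
    (hx : x ∉ failure s t G M z W adv N) : 1 ≤ cutSetTime b (M · x.1.1) (z · x.1.1) ∧
      ∃ i ≤ cutSetTime b (M · x.1.1) (z · x.1.1), (session s t G W adv x).DecodesAt i := by
  simp only [failure, Set.mem_union, Set.mem_iUnion, not_or, not_exists, Set.mem_preimage,
    Finset.mem_range] at hx
  obtain ⟨h1, h2⟩ := hx
  simp only [unmet, Set.mem_ofPred_eq, not_forall, not_not] at h1
  obtain ⟨k, hk, hcut⟩ := h1
  have hle : cutSetTime b (M · x.1.1) (z · x.1.1) ≤ k := Nat.sInf_le hcut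
  have hspec := hcut.cutSetTime_spec
  refine ⟨hspec.1, Session.exists_decodesAt _ hspec.1 ?_ fun i hi hi' => ?_⟩
  · by_contra hcon
    exact (h2 _ (by omega)).1 ⟨hspec, hcon⟩
  · by_contra hcon
    exact (h2 i (by omega)).2 ⟨hi, hcon⟩

theorem Session.rate_nonneg {V F : Type*} [DecidableEq V] [Field F] {m n b : ℕ}
    (S : Session V F m n b) : 0 ≤ S.rate := by
  by_cases h : ∃ i, S.DecodesAt i
  · obtain ⟨i, hi⟩ := h
    rw [S.rate_eq_of_decodesAt hi]
    positivity
  · rw [S.rate_eq_zero h]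

theorem Session.rate_le {V F : Type*} [DecidableEq V] [Field F] {m n b : ℕ}
    (S : Session V F m n b) : S.rate ≤ b := by
  by_cases h : ∃ i, S.DecodesAt i
  · obtain ⟨i, hi⟩ := h
    rw [S.rate_eq_of_decodesAt hi]
    exact div_le_self (by positivity) (by exact_mod_cast hi.1.1)
  · rw [S.rate_eq_zero h]
    positivity

theorem measurable_rate (hG : ∀ i g, MeasurableSet {ω | G i ω = g}) :
    Measurable fun x => (session s t G W adv x).rate := by
  classical
  -- The default `0` matches rate zero, since `b / 0 = 0`.
  let τ : (Ω × PublicCoins F m b) × SecretCoins F → ℕ := fun x =>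
    if h : ∃ i, (session s t G W adv x).DecodesAt i then h.choose else 0
  have hdec : ∀ i, MeasurableSet {x | (session s t G W adv x).DecodesAt i} := fun i =>
    measurableSet_session W adv hG i (p := fun S => S.DecodesAt i) fun _ _ h => h.decodesAt_iff
  have hτ : ∀ x i, (session s t G W adv x).DecodesAt i → τ x = i := by
    intro x i hi
    have hex : ∃ i, (session s t G W adv x).DecodesAt i := ⟨i, hi⟩
    simp only [τ, dif_pos hex]
    exact hex.choose_spec.unique hi
  have hτ0 : ∀ x, (¬ ∃ i, (session s t G W adv x).DecodesAt i) → τ x = 0 := fun x h => dif_neg h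
  have hm : Measurable τ := by
    refine measurable_to_countable' fun k => ?_
    have : τ ⁻¹' {k} = {x | (session s t G W adv x).DecodesAt k} ∪
        ({x | k = 0} ∩ ⋂ i, {x | (session s t G W adv x).DecodesAt i}ᶜ) := by
      ext x
      simp only [Set.mem_preimage, Set.mem_singleton_iff, Set.mem_union, Set.mem_inter_iff,
        Set.mem_iInter, Set.mem_compl_iff, Set.mem_ofPred_eq]
      by_cases h : ∃ i, (session s t G W adv x).DecodesAt i
      · obtain ⟨i, hi⟩ := h
        rw [hτ x i hi]
        exact ⟨fun h => Or.inl (h ▸ hi), fun h => h.elim (fun hk => hi.unique hk)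
          fun h => absurd hi (h.2 i)⟩
      · rw [hτ0 x h]
        push Not at h
        exact ⟨fun hk => Or.inr ⟨hk.symm, h⟩, fun hk => hk.elim (fun hk => absurd hk (h k))
          fun h => h.1.symm⟩
    rw [this]
    exact (hdec k).union ((MeasurableSet.const _).inter (MeasurableSet.iInter fun i =>
      (hdec i).compl))
  have heq : (fun x => (session s t G W adv x).rate) = fun x => (b : ℝ) / (τ x : ℝ) := by
    funext x
    by_cases h : ∃ i, (session s t G W adv x).DecodesAt i
    · obtain ⟨i, hi⟩ := h
      rw [hτ x i hi, Session.rate_eq_of_decodesAt _ hi]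
    · rw [hτ0 x h, Session.rate_eq_zero _ h]
      simp
  rw [heq]
  exact (measurable_from_top (f := fun k : ℕ => (b : ℝ) / k)).comp hm

/-- Off the failure event Bob decodes by the cut-set time, and stopping earlier only raises the
rate; on it, `b` bounds the loss. -/
theorem div_cutSetTime_le_rate_add {V F : Type*} [DecidableEq V] [Field F] [MeasurableSpace F]
    {s t : V} {G : ℕ → Ω → Hypernet V m} (W : Matrix (Fin b) (Fin n) F)
    (adv : Adversary Ω F m n b) {N : ℕ} (x : (Ω × PublicCoins F m b) × SecretCoins F) :
    (b : ℝ) / (cutSetTime b (M · x.1.1) (z · x.1.1) : ℝ) ≤ (session s t G W adv x).rate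
      + (failure s t G M z W adv N).indicator (fun _ => (b : ℝ)) x := by
  by_cases hx : x ∈ failure s t G M z W adv N
  · rw [Set.indicator_of_mem hx]
    have h1 := (session s t G W adv x).rate_nonneg
    have h2 : (b : ℝ) / (cutSetTime b (M · x.1.1) (z · x.1.1) : ℝ) ≤ b := by
      rcases Nat.eq_zero_or_pos (cutSetTime b (M · x.1.1) (z · x.1.1)) with h | h
      · rw [h]; simp
      · exact div_le_self (by positivity) (by exact_mod_cast h)
    linarith
  · rw [Set.indicator_of_notMem hx, add_zero]
    obtain ⟨-, i, hi, hdec⟩ := exists_decodesAt_of_notMem_failure hx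
    rw [Session.rate_eq_of_decodesAt _ hdec]
    have : (0 : ℝ) < i := by exact_mod_cast hdec.1.1
    gcongr

theorem le_integral_rate (hG : ∀ i g, MeasurableSet {ω | G i ω = g})
    (hM : ∀ i, Measurable (M i)) (hz : ∀ i, Measurable (z i)) (N : ℕ) :
    (∫ ω, (b : ℝ) / (cutSetTime b (M · ω) (z · ω) : ℝ) ∂P)
        - b * (jointLaw P F m b).real (failure s t G M z W adv N)
      ≤ ∫ x, (session s t G W adv x).rate ∂(jointLaw P F m b) := by
  have hfst : MeasurePreserving (fun x : (Ω × PublicCoins F m b) × SecretCoins F => x.1.1)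
      (jointLaw P F m b) P := measurePreserving_fst.comp measurePreserving_fst
  have hint := integrable_div_cutSetTime (P := P) (b := b) hM hz
  have h1 : ∫ x, (b : ℝ) / (cutSetTime b (M · x.1.1) (z · x.1.1) : ℝ) ∂(jointLaw P F m b)
      = ∫ ω, (b : ℝ) / (cutSetTime b (M · ω) (z · ω) : ℝ) ∂P := by
    have h := integral_map (f := fun ω => (b : ℝ) / (cutSetTime b (M · ω) (z · ω) : ℝ))
      hfst.aemeasurable (by rw [hfst.map_eq]; exact hint.aestronglyMeasurable)
    rw [hfst.map_eq] at h
    exact h.symm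
  have hrate : Integrable (fun x => (session s t G W adv x).rate) (jointLaw P F m b) :=
    Integrable.of_bound (measurable_rate W adv hG).aestronglyMeasurable (b : ℝ)
      (Filter.Eventually.of_forall fun x => by
        rw [Real.norm_of_nonneg (Session.rate_nonneg _)]
        exact Session.rate_le _)
  have hfail := measurableSet_failure (s := s) (t := t) W adv hG hM hz N
  have hind : Integrable ((failure s t G M z W adv N).indicator fun _ => (b : ℝ))
      (jointLaw P F m b) := (integrable_const _).indicator hfail
  have h2 := integral_mono (hfst.integrable_comp_of_integrable hint) (hrate.add hind)
    fun x => div_cutSetTime_le_rate_add (N := N) W adv x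
  simp only [Function.comp_def, Pi.add_apply] at h2
  rw [h1, integral_add hrate hind, integral_indicator_const _ hfail, smul_eq_mul] at h2
  linarith

end Events

/-- The probabilities decrease in the number of stages and their partial sums stay bounded, so they
cannot all exceed `δ`. -/
theorem exists_measureReal_unmet_le {Ω : Type*} [MeasurableSpace Ω] {P : Measure Ω}
    [IsProbabilityMeasure P] {b cbar : ℕ} {M z : ℕ → Ω → ℕ}
    (hM : ∀ i, Measurable (M i)) (hz : ∀ i, Measurable (z i))
    (hMc : ∀ i ω, M i ω ≤ cbar) (hzc : ∀ i ω, z i ω ≤ cbar)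
    (hindep : iIndepFun (fun i ω => (M i ω, z i ω)) P)
    (hident : ∀ i, IdentDistrib (fun ω => (M i ω, z i ω)) (fun ω => (M 0 ω, z 0 ω)) P P)
    (hb : 0 < b) (hmean : 0 < (∫ ω, (M 0 ω : ℝ) ∂P) - ∫ ω, (z 0 ω : ℝ) ∂P)
    {δ : ℝ} (hδ : 0 < δ) : ∃ N, P.real (unmet b M z N) ≤ δ := by
  have hsum := fun k => sum_measureReal_unmet_mul_le hM hz hMc hzc hindep hident hb k
  set μ := (∫ ω, (M 0 ω : ℝ) ∂P) - ∫ ω, (z 0 ω : ℝ) ∂P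
  obtain ⟨k, hk⟩ := exists_nat_gt (((b : ℝ) + cbar - 1) / (δ * μ))
  rw [div_lt_iff₀ (by positivity)] at hk
  refine ⟨k, le_of_not_gt fun hlt => ?_⟩
  have hle : ∀ j ∈ Finset.range k, δ ≤ P.real (unmet b M z j) := fun j hj =>
    hlt.le.trans <| measureReal_mono fun ω hω i hi =>
      hω i (hi.trans (Finset.mem_range.1 hj).le)
  have h1 : (k : ℝ) * δ ≤ ∑ j ∈ Finset.range k, P.real (unmet b M z j) := by
    simpa using Finset.card_nsmul_le_sum (Finset.range k) _ _ hle
  have h2 := mul_le_mul_of_nonneg_right h1 hmean.le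
  have h3 := hsum k
  linarith

end RatelessCode

end

/-! ### Assembly: choice of the horizon and of the field size -/

theorem theorem2 {V : Type*} [Fintype V] [DecidableEq V] (s t : V) (m n b cbar : ℕ) (hb : 0 < b)
    {Ω : Type*} [MeasurableSpace Ω] (P : MeasureTheory.Measure Ω)
    [MeasureTheory.IsProbabilityMeasure P]
    (G : ℕ → Ω → RatelessCode.Hypernet V m) (hG : ∀ i g, MeasurableSet {ω | G i ω = g})
    (M z : ℕ → Ω → ℕ) (hM : ∀ i ω, M i ω = (G i ω).capacity s t) (hz : ∀ i, Measurable (z i))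
    (hc : ∀ i ω, (G i ω).opportunities s ≤ cbar)
    (hzc : ∀ i ω, z i ω ≤ (G i ω).opportunities s)
    (hindep : ProbabilityTheory.iIndepFun (fun i ω => (M i ω, z i ω)) P)
    (hident : ∀ i, ProbabilityTheory.IdentDistrib
      (fun ω => (M i ω, z i ω)) (fun ω => (M 0 ω, z 0 ω)) P P)
    (ε : ℝ) (hε : 0 < ε)
    (hmean : ε ≤ (∫ ω, (M 0 ω : ℝ) ∂P) - ∫ ω, (z 0 ω : ℝ) ∂P) :
    -- the cut-set condition is met after finitely many stages, almost surely
    (∀ᵐ ω ∂P, ∃ i, RatelessCode.CutSet b (M · ω) (z · ω) i) ∧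
    -- as the field grows, uniformly over messages and adversaries,
    (∀ δ : ℝ, 0 < δ → ∃ q₀ : ℕ, ∀ (F : Type) [Field F] [Fintype F] [MeasurableSpace F]
      [DiscreteMeasurableSpace F], q₀ ≤ Fintype.card F →
      ∀ (W : Matrix (Fin b) (Fin n) F) (adv : RatelessCode.Adversary Ω F m n b),
      (∀ i x, (G i x.1).minCut s t (adv.loc i x) ≤ z i x.1) →
      -- Bob decodes correctly no later than when the cut-set condition is first met,
      1 - δ ≤ (RatelessCode.jointLaw P F m b).real {x | ∃ i,
        i ≤ RatelessCode.cutSetTime b (M · x.1.1) (z · x.1.1) ∧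
        (RatelessCode.session s t G W adv x).DecodesAt i} ∧
      -- and the expected rate of the code is at least that of the cut-set condition
      (∫ ω, (b : ℝ) / (RatelessCode.cutSetTime b (M · ω) (z · ω) : ℝ) ∂P) - δ ≤
        ∫ x, (RatelessCode.session s t G W adv x).rate ∂(RatelessCode.jointLaw P F m b)) ∧
    -- the rate bound
    (b : ℝ) / ((b : ℝ) + cbar - 1) *
        ((∫ ω, (M 0 ω : ℝ) ∂P) - ∫ ω, (z 0 ω : ℝ) ∂P) ≤
      ∫ ω, (b : ℝ) / (RatelessCode.cutSetTime b (M · ω) (z · ω) : ℝ) ∂P := by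
  have hMm : ∀ i, Measurable (M i) := fun i => measurable_to_countable' fun k => by
    refine RatelessCode.measurableSet_of_factors (G i) (hG i) fun ω ω' h hω => ?_
    rw [Set.mem_preimage, hM, h] at *
    exact hω
  have hMc : ∀ i ω, M i ω ≤ cbar := fun i ω => by
    rw [hM]
    exact ((G i ω).capacity_le_opportunities s t).trans (hc i ω)
  have hzc' : ∀ i ω, z i ω ≤ cbar := fun i ω => (hzc i ω).trans (hc i ω)
  have hpos : 0 < (∫ ω, (M 0 ω : ℝ) ∂P) - ∫ ω, (z 0 ω : ℝ) ∂P := hε.trans_le hmean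
  refine ⟨RatelessCode.ae_exists_cutSet hMm hz hMc hzc' hindep hident hb hpos, ?_,
    RatelessCode.le_integral_div_cutSetTime hMm hz hMc hzc' hindep hident hb hpos⟩
  intro δ hδ
  have hb1 : (1 : ℝ) ≤ b := by exact_mod_cast hb
  -- A failure costs up to `b` in rate, so its probability must be at most `δ / b`. Half goes to the
  -- tail of the cut-set time, which fixes `N` independently of the field; then `q₀` handles the
  -- coins.
  have hδb : 0 < δ / b := by positivity
  obtain ⟨N, hN⟩ := RatelessCode.exists_measureReal_unmet_le hMm hz hMc hzc' hindep hident hb hpos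
    (half_pos hδb)
  obtain ⟨q₀, hq₀⟩ := exists_nat_gt (RatelessCode.failureConstant m n b N / (δ / b / 2))
  refine ⟨q₀, fun F _ _ _ _ hq W adv hadv => ?_⟩
  have hfail : (RatelessCode.jointLaw P F m b).real
      (RatelessCode.failure s t G M z W adv N) ≤ δ / b := by
    refine (RatelessCode.jointLaw_failure_le W adv hG hMm hz hM hzc hadv N).trans ?_
    have h1 : (RatelessCode.failureConstant m n b N : ℝ) / Fintype.card F ≤ δ / b / 2 := by
      have hq' : (q₀ : ℝ) ≤ Fintype.card F := by exact_mod_cast hq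
      rw [div_le_iff₀ (by exact_mod_cast Fintype.card_pos)]
      rw [div_lt_iff₀ (half_pos hδb), mul_comm] at hq₀
      exact hq₀.le.trans (mul_le_mul_of_nonneg_left hq' (half_pos hδb).le)
    linarith
  constructor
  · have hcover : Set.univ ⊆ RatelessCode.failure s t G M z W adv N ∪ {x | ∃ i,
        i ≤ RatelessCode.cutSetTime b (M · x.1.1) (z · x.1.1) ∧
        (RatelessCode.session s t G W adv x).DecodesAt i} := by
      intro x _
      by_cases hx : x ∈ RatelessCode.failure s t G M z W adv N
      · exact Or.inl hx
      · exact Or.inr (RatelessCode.exists_decodesAt_of_notMem_failure hx).2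
    have h1 := (measureReal_mono hcover).trans
      (measureReal_union_le (μ := RatelessCode.jointLaw P F m b) _ _)
    rw [probReal_univ] at h1
    have h2 : δ / b ≤ δ := div_le_self hδ.le hb1
    linarith
  · have h1 := RatelessCode.le_integral_rate (P := P) (s := s) (t := t) W adv hG hMm hz N
    have h2 : (b : ℝ) * (RatelessCode.jointLaw P F m b).real
        (RatelessCode.failure s t G M z W adv N) ≤ δ := by
      calc _ ≤ (b : ℝ) * (δ / b) := mul_le_mul_of_nonneg_left hfail (by positivity)
        _ = δ := by field_simp
    linarith
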